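/- **Setting.** Let $u\ge 0$. For $\nu=1,2,\dots$ consider an $m_\nu\times n_\nu$ grid of sites $\mathbf s=(x,y)\in\mathbb Z^2$, with $N=N_\nu=m_\nu n_\nu\to\infty$. For each $\nu$ and each site $\mathbf s$ let $\mathbf t_{\mathbf s}=(1,t_{\mathbf s1},\dots,t_{\mathbf su})$, $t_{\mathbf sj}\in\{0,1\}$, be a fixed covariate vector, and for $\boldsymbol\beta\in\mathbb R^{u+1}$ put $$\theta_{\mathbf s}(\boldsymbol\beta)=\frac{\exp(\mathbf t_{\mathbf s}^T\boldsymbol\beta)}{1+\exp(\mathbf t_{\mathbf s}^T\boldsymbol\beta)},\qquad \sigma_{\mathbf s}=\sqrt{\theta_{\mathbf s}(1-\theta_{\mathbf s})},\qquad \mathbf P_{\mathbf sj}=\frac{\partial\theta_{\mathbf s}}{\partial\beta_j}=t_{\mathbf sj}\,\theta_{\mathbf s}(1-\theta_{\mathbf s})\quad(t_{\mathbf s0}=1).$$ Let $Y(\mathbf s)$ be $\{0,1\}$-valued random variables with $E\,Y(\mathbf s)=\theta_{\mathbf s}(\boldsymbol\beta_0)$, where $\boldsymbol\beta_0$ is the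 true parameter (the same for all $\nu$). Let $p\in[1,\infty)$, $a\in(0,1]$, $\rho\in[0,1]$, $(a,\rho)\ne(1,1)$; let $d$ be the $L_p$ distance; and let $\boldsymbol\Gamma$ be the $N\times N$ matrix with $\boldsymbol\Gamma_{\mathbf s\mathbf s}=1$ and $\boldsymbol\Gamma_{\mathbf s\mathbf r}=a\rho^{d(\mathbf s,\mathbf r)}$ for $\mathbf s\ne\mathbf r$. Let $\mathbf V(\boldsymbol\beta)_{\mathbf s\mathbf r}=\sigma_{\mathbf s}\sigma_{\mathbf r}\boldsymbol\Gamma_{\mathbf s\mathbf r}$, and define the quasi-score function $$\mathbf U(\boldsymbol\beta)=\mathbf P^T\mathbf V^{-1}\bigl(\mathbf Y-\boldsymbol\theta(\boldsymbol\beta)\bigr).$$ **Assumptions.** 1. $\operatorname{corr}(Y(\mathbf s),Y(\mathbf r))=a\rho^{d(\mathbf s,\mathbf r)}$ for all sites $\mathbf s\neq\mathbf r$ of the same grid. 2. For each $k\ge 3$ there is $\alpha_k<k/2$ such that the sum of the joint cumulants of order $k$ of the centered variables $Y(\mathbf s)-\theta_{\mathbf s}(\boldsymbol\beta_0)$, taken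 over all $k$-tuples of pairwise distinct sites, is $O(N^{\alpha_k})$. 3. The matrix $\frac1N\mathbf D_{\boldsymbol\beta}\mathbf U(\boldsymbol\beta_0)$ is negative definite, uniformly in $N$, with probability going to 1: for some constant $c>0$, with probability going to 1 as $\nu\to\infty$, $\mathbf x^T\frac1N\mathbf D_{\boldsymbol\beta}\mathbf U(\boldsymbol\beta_0)\,\mathbf x\le -c\|\mathbf x\|^2$ for all $\mathbf x\in\mathbb R^{u+1}$. **Lemma 2.3.** The quasi-likelihood estimate, that is, the root of $\mathbf U(\boldsymbol\beta)=\mathbf 0$ within a neighbourhood of the true parameter, is consistent. Precisely, there is $r_0>0$ such that (i) with probability going to 1, the equation $\mathbf U(\boldsymbol\beta)=\mathbf 0$ has exactly one root in the open ball $B(\boldsymbol\beta_0,r_0)$; (ii) whenever $\hat{\boldsymbol\beta}=\hat{\boldsymbol\beta}_\nu$ satisfies $\hat{\boldsymbol\beta}\in B(\boldsymbol\beta_0,r_0)$ and $\mathbf U(\hat{\boldsymbol\beta})=\mathbf 0$ with probability going to 1, $\hat{\boldsymbol\beta}\to\boldsymbol\beta_0$ in probability. -/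

import Mathlib

open MeasureTheory ProbabilityTheory Filter Topology
open scoped Matrix

namespace SpatialQL

noncomputable section

/-- The sites of an `m × n` grid. -/
abbrev Site (m n : ℕ) : Type := Fin m × Fin n

/-- The parameter space `ℝ^(u+1)` of `β = (β_0, …, β_u)`, with the Euclidean norm. -/
abbrev Param (u : ℕ) : Type := EuclideanSpace ℝ (Fin (u + 1))

/-- The `L_p` distance in the plane between two grid sites. -/
def lpDist (p : ℝ) {m n : ℕ} (s r : Site m n) : ℝ :=
  (|((s.1 : ℕ) : ℝ) - ((r.1 : ℕ) : ℝ)| ^ p + |((s.2 : ℕ) : ℝ) - ((r.2 : ℕ) : ℝ)| ^ p) ^ (1 / p)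

/-- The matrix `Γ` with entries `1` on the diagonal and `a ρ^{d(s, r)}` off the diagonal,
where `d` is the `L_p` distance. -/
def corrMatrix (a ρ p : ℝ) (m n : ℕ) : Matrix (Site m n) (Site m n) ℝ :=
  Matrix.of fun s r => if s = r then 1 else a * ρ ^ lpDist p s r

/-- Pearson correlation of two real random variables. -/
def corr {Ω : Type*} [MeasurableSpace Ω] (μ : Measure Ω) (X Y : Ω → ℝ) : ℝ :=
  cov[X, Y; μ] / (Real.sqrt (Var[X; μ]) * Real.sqrt (Var[Y; μ]))

/-- The joint cumulant of `Z_1, …, Z_k`: the sum over all set partitions `π` of `{1, …, k}` of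
`(-1)^{|π| - 1} (|π| - 1)! ∏_{B ∈ π} E[∏_{j ∈ B} Z_j]`. -/
def jointCumulant {Ω : Type*} [MeasurableSpace Ω] (μ : Measure Ω) {k : ℕ}
    (Z : Fin k → Ω → ℝ) : ℝ :=
  ∑ π : Finpartition (Finset.univ : Finset (Fin k)),
    (-1 : ℝ) ^ (π.parts.card - 1) * (Nat.factorial (π.parts.card - 1) : ℝ) *
      ∏ B ∈ π.parts, ∫ ω, ∏ j ∈ B, Z j ω ∂μ

section Model

variable {u m n : ℕ}

/-- The logistic mean `θ_s(β) = exp(t_sᵀ β) / (1 + exp(t_sᵀ β))`; `t s` is the row of the design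
matrix `T` at the site `s`. -/
def meanResp (t : Site m n → Fin (u + 1) → ℝ) (β : Param u) (s : Site m n) : ℝ :=
  Real.exp (∑ j, t s j * β j) / (1 + Real.exp (∑ j, t s j * β j))

/-- The derivative matrix `P = ∂θ/∂β`, with entries `t_{sj} θ_s (1 - θ_s)`. -/
def derivMatrix (t : Site m n → Fin (u + 1) → ℝ) (β : Param u) :
    Matrix (Site m n) (Fin (u + 1)) ℝ :=
  Matrix.of fun s j => t s j * (meanResp t β s * (1 - meanResp t β s))

/-- The working covariance matrix `V(β)`, with entries `σ_s(β) σ_r(β) Γ_{sr}`, where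
`σ_s = √(θ_s (1 - θ_s))`. -/
def covMatrix (Γ : Matrix (Site m n) (Site m n) ℝ) (t : Site m n → Fin (u + 1) → ℝ)
    (β : Param u) : Matrix (Site m n) (Site m n) ℝ :=
  Matrix.of fun s r =>
    Real.sqrt (meanResp t β s * (1 - meanResp t β s)) *
      Real.sqrt (meanResp t β r * (1 - meanResp t β r)) * Γ s r

/-- The quasi-score function `U(β; y) = P(β)ᵀ V(β)⁻¹ (y - θ(β))`. -/
def quasiScore (Γ : Matrix (Site m n) (Site m n) ℝ) (t : Site m n → Fin (u + 1) → ℝ)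
    (y : Site m n → ℝ) (β : Param u) : Param u :=
  WithLp.toLp 2
    ((derivMatrix t β)ᵀ *ᵥ ((covMatrix Γ t β)⁻¹ *ᵥ fun s => y s - meanResp t β s))

end Model

end

end SpatialQL

/-! Write `F = U/N`. The claim is a perturbation argument around `β₀`. If `F(β₀)` tends to 0 in
probability, and `F` is Lipschitz and strongly monotone (decreasing) on a fixed ball with constants
independent of the grid, then a contraction gives exactly one root in the ball. Strong monotonicity
alone bounds the distance of a root from `β₀` by a multiple of `‖F(β₀)‖`.

All uniformity comes from a lower bound `δ > 0`, valid for every grid, on the quadratic form of `Γ`.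
Since `V = diag(σ) Γ diag(σ)`, the score in a direction `w` is a bilinear form in the fixed matrix
`Γ⁻¹`, and only its two vectors depend on `β`. With `‖Γ⁻¹‖ ≤ 1/δ` the derivative of `F` is bounded
and Lipschitz near `β₀`, so negative definiteness at `β₀` persists on a small ball. The standardized
residuals have covariance exactly `Γ`, so each component of `U(β₀)` has variance `fᵀ Γ⁻¹ f ≤ N/δ`,
and Chebyshev gives `F(β₀) → 0`. Second moments suffice.

The bound `δ` has two sources. First, the planar `L_p` norm restricted to a grid is a nonnegative
combination of absolute values of linear forms (`planeNorm_eq_sum_abs`), hence `d` is a nonnegative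
combination of cuts. Secondly, choose cuts independently so that `exp(-d(x,y))` is the probability
that no chosen cut separates `x` from `y`. The kernel is then an average of quadratic forms of
partitions, each at least the sum of `v x ^ 2` over isolated points. Separation is increasing in the
set of chosen cuts, so by the FKG inequality `x` is isolated with probability at least `∏ (1 -
exp(-d(x,y)))`, the product being over `y ≠ x`. For `ρ^d` with `ρ < 1` this product is bounded below
because `∑ ρ^d` is bounded uniformly in the grid. For `ρ = 1` the term `(1 - a) I` does the work. -/

/-! ### Cut semimetrics -/

/-- A finite semimetric is a cut semimetric if it is a nonnegative combination of the semimetrics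
`(x, y) ↦ 1[H separates x and y]`. -/
def IsCutSemimetric {ι : Type*} [Fintype ι] [DecidableEq ι] (d : ι → ι → ℝ) : Prop :=
  ∃ w : Finset ι → ℝ, (∀ H, 0 ≤ w H) ∧
    ∀ x y, d x y = ∑ H, w H * (if (x ∈ H ↔ y ∈ H) then 0 else 1)

namespace IsCutSemimetric

variable {ι : Type*} [Fintype ι] [DecidableEq ι]

theorem zero : IsCutSemimetric (fun _ _ : ι => (0 : ℝ)) :=
  ⟨fun _ => 0, fun _ => le_rfl, fun x y => by simp⟩

theorem add {d e : ι → ι → ℝ} (hd : IsCutSemimetric d) (he : IsCutSemimetric e) :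
    IsCutSemimetric (fun x y => d x y + e x y) := by
  obtain ⟨w, hw, hd⟩ := hd
  obtain ⟨w', hw', he⟩ := he
  refine ⟨fun H => w H + w' H, fun H => add_nonneg (hw H) (hw' H), fun x y => ?_⟩
  simp only [hd, he, add_mul, Finset.sum_add_distrib]

theorem const_mul {d : ι → ι → ℝ} (hd : IsCutSemimetric d) {c : ℝ} (hc : 0 ≤ c) :
    IsCutSemimetric (fun x y => c * d x y) := by
  obtain ⟨w, hw, hd⟩ := hd
  refine ⟨fun H => c * w H, fun H => mul_nonneg hc (hw H), fun x y => ?_⟩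
  simp only [hd, Finset.mul_sum, mul_assoc]

theorem sum {κ : Type*} (s : Finset κ) {d : κ → ι → ι → ℝ}
    (hd : ∀ k ∈ s, IsCutSemimetric (d k)) :
    IsCutSemimetric (fun x y => ∑ k ∈ s, d k x y) := by
  classical
  induction s using Finset.induction_on with
  | empty => simpa using zero
  | insert a s ha ih =>
    simp only [Finset.sum_insert ha]
    exact (hd a (Finset.mem_insert_self a s)).add
      (ih fun k hk => hd k (Finset.mem_insert_of_mem hk))

theorem single (H : Finset ι) :
    IsCutSemimetric (fun x y => if (x ∈ H ↔ y ∈ H) then (0 : ℝ) else 1) := by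
  refine ⟨fun H' => if H' = H then 1 else 0, fun H' => by positivity, fun x y => ?_⟩
  simp only [ite_mul, one_mul, zero_mul, Finset.sum_ite_eq', Finset.mem_univ, if_true]

/-- The distance between two integers counts the thresholds `t` lying between them, and each
threshold is the cut `{x | f x ≤ t}`. -/
theorem abs_sub_nat (f : ι → ℕ) : IsCutSemimetric (fun x y => |(f x : ℝ) - f y|) := by
  obtain ⟨B, hB⟩ : ∃ B, ∀ x, f x ≤ B :=
    ⟨Finset.univ.sup f, fun x => Finset.le_sup (Finset.mem_univ x)⟩
  have key : ∀ a b : ℕ, a ≤ b → b ≤ B →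
      ((b : ℝ) - a) = ∑ t ∈ Finset.range B, if (a ≤ t ↔ b ≤ t) then (0 : ℝ) else 1 := by
    intro a b hab hb
    have : ∀ t ∈ Finset.range B, (if (a ≤ t ↔ b ≤ t) then (0 : ℝ) else 1)
        = if t ∈ Finset.Ico a b then 1 else 0 := by
      intro t _
      simp only [Finset.mem_Ico]
      split_ifs <;> first | rfl | (exfalso; omega)
    rw [Finset.sum_congr rfl this, Finset.sum_ite_mem, Finset.inter_eq_right.2]
    · simp [Nat.cast_sub hab]
    · intro t ht
      simp only [Finset.mem_Ico, Finset.mem_range] at *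
      omega
  have := sum (Finset.range B) (fun t _ => single (Finset.univ.filter fun x : ι => f x ≤ t))
  convert this using 3 with x y
  simp only [Finset.mem_filter, Finset.mem_univ, true_and]
  rcases le_total (f x) (f y) with h | h
  · rw [abs_sub_comm, abs_of_nonneg (by simpa using h), key _ _ h (hB y)]
  · rw [abs_of_nonneg (by simpa using h), key _ _ h (hB x)]
    simp only [iff_comm]

theorem abs_sub_int (f : ι → ℤ) : IsCutSemimetric (fun x y => |(f x : ℝ) - f y|) := by
  obtain ⟨B, hB⟩ : ∃ B : ℕ, ∀ x, 0 ≤ f x + B := by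
    refine ⟨Finset.univ.sup fun x => (f x).natAbs, fun x => ?_⟩
    have : (f x).natAbs ≤ Finset.univ.sup fun x => (f x).natAbs :=
      Finset.le_sup (f := fun x => (f x).natAbs) (Finset.mem_univ x)
    omega
  convert abs_sub_nat (fun x => (f x + B).toNat) using 4 with x y
  have h : ∀ x, (((f x + B).toNat : ℕ) : ℝ) = f x + B := fun x => by
    have := Int.toNat_of_nonneg (hB x)
    exact_mod_cast congrArg (Int.cast : ℤ → ℝ) this
  rw [h, h]; ring

end IsCutSemimetric

/-! ### Random cuts and positive definiteness of `exp (-d)` -/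

section RandomCuts

variable {ι : Type*} [Fintype ι] [DecidableEq ι]

/-- The quadratic form of a partition dominates the part coming from the singleton blocks. -/
theorem sum_sq_isolated_le {κ : Type*} [DecidableEq κ] (c : ι → κ) (v : ι → ℝ) :
    ∑ x, (if ∀ y, y ≠ x → c x ≠ c y then 1 else 0) * v x ^ 2 ≤
      ∑ x, ∑ y, v x * v y * (if c x = c y then 1 else 0) := by
  -- Grouped by blocks, the form is the sum of the squared block sums; blocks with several points
  -- can be discarded.
  have h1 : ∑ x, ∑ y, v x * v y * (if c x = c y then 1 else 0)
      = ∑ k ∈ Finset.univ.image c, (∑ x ∈ Finset.univ.filter (c · = k), v x) ^ 2 := by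
    rw [← Finset.sum_fiberwise_of_maps_to (s := Finset.univ) (t := Finset.univ.image c) (g := c)
      (fun x _ => Finset.mem_image_of_mem c (Finset.mem_univ x))]
    refine Finset.sum_congr rfl fun k _ => ?_
    rw [sq, Finset.sum_mul_sum]
    refine Finset.sum_congr rfl fun x hx => ?_
    rw [Finset.sum_filter]
    refine Finset.sum_congr rfl fun y _ => ?_
    rw [(Finset.mem_filter.1 hx).2]
    by_cases h : c y = k
    · simp [h]
    · simp [h, Ne.symm h]
  rw [h1, ← Finset.sum_fiberwise_of_maps_to (s := Finset.univ) (t := Finset.univ.image c) (g := c)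
      (fun x _ => Finset.mem_image_of_mem c (Finset.mem_univ x))]
  refine Finset.sum_le_sum fun k _ => ?_
  by_cases hk : ∃ x, c x = k ∧ ∀ y, y ≠ x → c x ≠ c y
  · obtain ⟨x, hx, hiso⟩ := hk
    have : Finset.univ.filter (c · = k) = {x} := by
      ext y
      simp only [Finset.mem_filter, Finset.mem_univ, true_and, Finset.mem_singleton]
      refine ⟨fun hy => ?_, fun hy => hy ▸ hx⟩
      by_contra hne
      exact hiso y hne (hx.trans hy.symm)
    rw [this, Finset.sum_singleton, Finset.sum_singleton, if_pos hiso, one_mul]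
  · rw [Finset.sum_eq_zero]
    · positivity
    · intro x hx
      rw [if_neg, zero_mul]
      exact fun h => hk ⟨x, (Finset.mem_filter.1 hx).2, h⟩

/-- The product weight on subsets, in which `H` is chosen with probability `1 - q H`. -/
def subsetWeight {κ : Type*} [Fintype κ] [DecidableEq κ] (q : κ → ℝ) (T : Finset κ) : ℝ :=
  (∏ H ∈ T, (1 - q H)) * ∏ H ∈ Tᶜ, q H

variable {κ : Type*} [Fintype κ] [DecidableEq κ] {q : κ → ℝ}

theorem subsetWeight_nonneg (h0 : ∀ H, 0 ≤ q H) (h1 : ∀ H, q H ≤ 1) (T : Finset κ) :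
    0 ≤ subsetWeight q T :=
  mul_nonneg (Finset.prod_nonneg fun H _ => sub_nonneg.2 (h1 H))
    (Finset.prod_nonneg fun H _ => h0 H)

/-- The probability that no set with the property `S` is chosen. -/
theorem sum_subsetWeight_avoid (S : κ → Prop) [DecidablePred S] :
    ∑ T, subsetWeight q T * (if ∀ H ∈ T, ¬ S H then 1 else 0) =
      ∏ H, if S H then q H else 1 := by
  -- Expanding the product over subsets encodes independence; the factor 0 on `S` kills every subset
  -- that meets `S`.
  have h := Finset.prod_add (fun H => (1 - q H) * (if S H then 0 else 1)) q Finset.univ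
  have h2 : ∏ H, ((1 - q H) * (if S H then 0 else 1) + q H) = ∏ H, if S H then q H else 1 := by
    refine Finset.prod_congr rfl fun H _ => ?_
    split_ifs <;> ring
  rw [← h2, h, Finset.powerset_univ]
  refine Finset.sum_congr rfl fun T _ => ?_
  have h3 : (if ∀ H ∈ T, ¬ S H then (1 : ℝ) else 0) = ∏ H ∈ T, if S H then (0 : ℝ) else 1 := by
    split_ifs with hS
    · exact (Finset.prod_eq_one fun H hH => if_neg (hS H hH)).symm
    · push Not at hS
      obtain ⟨H, hH, hS⟩ := hS
      symm
      apply Finset.prod_eq_zero hH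
      rw [if_pos hS]
  rw [subsetWeight, h3, Finset.prod_mul_distrib, Finset.compl_eq_univ_sdiff]
  ring

theorem sum_subsetWeight : ∑ T, subsetWeight q T = 1 := by
  have := sum_subsetWeight_avoid (q := q) (fun _ => False)
  simpa using this

/-- Product weights are log-modular: the lattice condition of the FKG inequality holds with
equality. -/
theorem subsetWeight_mul (S T : Finset κ) :
    subsetWeight q S * subsetWeight q T = subsetWeight q (S ⊓ T) * subsetWeight q (S ⊔ T) := by
  simp only [subsetWeight, Finset.inf_eq_inter, Finset.sup_eq_union, Finset.compl_inter,
    Finset.compl_union]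
  have h1 := Finset.prod_union_inter (s₁ := S) (s₂ := T) (f := fun H => 1 - q H)
  have h2 := Finset.prod_union_inter (s₁ := Sᶜ) (s₂ := Tᶜ) (f := q)
  calc _ = ((∏ H ∈ S, (1 - q H)) * ∏ H ∈ T, (1 - q H)) *
        ((∏ H ∈ Sᶜ, q H) * ∏ H ∈ Tᶜ, q H) := by ring
    _ = _ := by rw [← h1, ← h2]; ring

/-- Positive association of increasing functions under product weights. -/
theorem prod_sum_subsetWeight_le (h0 : ∀ H, 0 ≤ q H) (h1 : ∀ H, q H ≤ 1) {α : Type*}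
    (s : Finset α) (f : α → Finset κ → ℝ) (hf0 : ∀ a, 0 ≤ f a) (hf : ∀ a, Monotone (f a)) :
    ∏ a ∈ s, ∑ T, subsetWeight q T * f a T ≤ ∑ T, subsetWeight q T * ∏ a ∈ s, f a T := by
  classical
  have hw : 0 ≤ subsetWeight q := fun T => subsetWeight_nonneg h0 h1 T
  induction s using Finset.induction_on with
  | empty => simp [sum_subsetWeight]
  | insert a s ha ih =>
    simp only [Finset.prod_insert ha]
    have hmono : Monotone fun T => ∏ a ∈ s, f a T := fun T T' h =>
      Finset.prod_le_prod (fun a _ => hf0 a T) fun a _ => hf a h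
    have key := fkg (μ := subsetWeight q) (f := f a) (g := fun T => ∏ a ∈ s, f a T) hw (hf0 a)
      (fun T => Finset.prod_nonneg fun a _ => hf0 a T) (hf a) hmono
      (fun S T => (subsetWeight_mul S T).le)
    rw [sum_subsetWeight, one_mul] at key
    refine le_trans ?_ key
    exact mul_le_mul_of_nonneg_left ih
      (Finset.sum_nonneg fun T _ => mul_nonneg (hw T) (hf0 a T))

/-- The kernel `exp (-d)` of a cut semimetric `d` is positive definite, with an explicit bound. -/
theorem IsCutSemimetric.sum_exp_neg_ge {d : ι → ι → ℝ} (hd : IsCutSemimetric d) (v : ι → ℝ) :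
    ∑ x, (∏ y ∈ Finset.univ.erase x, (1 - Real.exp (-d x y))) * v x ^ 2 ≤
      ∑ x, ∑ y, v x * v y * Real.exp (-d x y) := by
  obtain ⟨w, hw, hd⟩ := hd
  set q : Finset ι → ℝ := fun H => Real.exp (-w H) with hq
  have h0 : ∀ H, 0 ≤ q H := fun H => (Real.exp_pos _).le
  have h1 : ∀ H, q H ≤ 1 := fun H => Real.exp_le_one_iff.2 (neg_nonpos.2 (hw H))
  -- The label of `x` records which chosen cuts contain it, so equal labels mean that no chosen cut
  -- separates the two points.
  let c : Finset (Finset ι) → ι → Finset (Finset ι) := fun T x => T.filter (x ∈ ·)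
  have hc : ∀ T x y, c T x = c T y ↔ ∀ H ∈ T, ¬ ¬ (x ∈ H ↔ y ∈ H) := by
    intro T x y
    simp only [c, Finset.filter_inj', not_not]
  have hexp : ∀ x y, Real.exp (-d x y) =
      ∑ T, subsetWeight q T * (if c T x = c T y then 1 else 0) := by
    intro x y
    simp only [hc]
    rw [sum_subsetWeight_avoid, hd, ← Finset.sum_neg_distrib, Real.exp_sum]
    refine Finset.prod_congr rfl fun H _ => ?_
    by_cases h : (x ∈ H ↔ y ∈ H) <;> simp [h, hq]
  have hsep : ∀ x y, 1 - Real.exp (-d x y) =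
      ∑ T, subsetWeight q T * (if c T x = c T y then 0 else 1) := by
    intro x y
    have h := sum_subsetWeight (q := q)
    rw [hexp, sub_eq_iff_eq_add, ← Finset.sum_add_distrib]
    refine h.symm.trans (Finset.sum_congr rfl fun T _ => ?_)
    split_ifs <;> ring
  -- Being separated from `y` is an increasing event in `T`, and isolation is the intersection of
  -- these events, so FKG applies.
  have hiso : ∀ x, ∏ y ∈ Finset.univ.erase x, (1 - Real.exp (-d x y)) ≤
      ∑ T, subsetWeight q T * (if ∀ y, y ≠ x → c T x ≠ c T y then 1 else 0) := by
    intro x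
    simp only [hsep]
    refine (prod_sum_subsetWeight_le h0 h1 _
      (fun y T => if c T x = c T y then (0 : ℝ) else 1) ?_ ?_).trans (le_of_eq ?_)
    · intro y T
      simp only [Pi.zero_apply]
      split_ifs <;> norm_num
    · intro y S T hST
      simp only
      by_cases h : c T x = c T y
      · have : c S x = c S y := by
          rw [hc] at h ⊢
          exact fun H hH => h H (hST hH)
        simp [h, this]
      · rw [if_neg h]
        split_ifs <;> norm_num
    · refine Finset.sum_congr rfl fun T _ => ?_
      congr 1
      split_ifs with h
      · exact Finset.prod_eq_one fun y hy => if_neg (h y (Finset.ne_of_mem_erase hy))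
      · push Not at h
        obtain ⟨y, hy, h⟩ := h
        exact Finset.prod_eq_zero (Finset.mem_erase.2 ⟨hy, Finset.mem_univ y⟩) (if_pos h)
  calc _ ≤ ∑ x, (∑ T, subsetWeight q T *
        (if ∀ y, y ≠ x → c T x ≠ c T y then 1 else 0)) * v x ^ 2 :=
        Finset.sum_le_sum fun x _ => mul_le_mul_of_nonneg_right (hiso x) (sq_nonneg _)
    _ = ∑ T, subsetWeight q T *
        ∑ x, (if ∀ y, y ≠ x → c T x ≠ c T y then 1 else 0) * v x ^ 2 := by
        simp only [Finset.sum_mul, Finset.mul_sum]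
        rw [Finset.sum_comm]
        simp only [mul_assoc]
    _ ≤ ∑ T, subsetWeight q T * ∑ x, ∑ y, v x * v y * (if c T x = c T y then 1 else 0) :=
        Finset.sum_le_sum fun T _ => mul_le_mul_of_nonneg_left (sum_sq_isolated_le (c T) v)
          (subsetWeight_nonneg h0 h1 T)
    _ = _ := by
        simp only [hexp, Finset.mul_sum]
        rw [Finset.sum_comm]
        refine Finset.sum_congr rfl fun x _ => ?_
        rw [Finset.sum_comm]
        refine Finset.sum_congr rfl fun y _ => Finset.sum_congr rfl fun T _ => ?_
        ring

end RandomCuts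

/-! ### The `L_p` norm of the plane -/

/-- The `L_p` norm in the plane. -/
noncomputable def planeNorm (p x y : ℝ) : ℝ := (|x| ^ p + |y| ^ p) ^ (1 / p)

section PlaneNorm

variable {p : ℝ}

theorem planeNorm_add_le (hp : 1 ≤ p) (x y x' y' : ℝ) :
    planeNorm p (x + x') (y + y') ≤ planeNorm p x y + planeNorm p x' y' := by
  have := Real.Lp_add_le (Finset.univ : Finset (Fin 2)) ![x, y] ![x', y'] hp
  simpa [planeNorm, Fin.sum_univ_two] using this

theorem planeNorm_mul (hp : 1 ≤ p) (c x y : ℝ) :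
    planeNorm p (c * x) (c * y) = |c| * planeNorm p x y := by
  have hp0 : p ≠ 0 := by linarith
  unfold planeNorm
  rw [abs_mul, abs_mul, Real.mul_rpow (abs_nonneg _) (abs_nonneg _),
    Real.mul_rpow (abs_nonneg _) (abs_nonneg _), ← mul_add,
    Real.mul_rpow (by positivity) (by positivity), ← Real.rpow_mul (abs_nonneg _),
    mul_one_div_cancel hp0, Real.rpow_one]

theorem planeNorm_abs_abs (x y : ℝ) : planeNorm p |x| |y| = planeNorm p x y := by
  simp [planeNorm]

theorem planeNorm_zero_right (hp : 1 ≤ p) (x : ℝ) : planeNorm p x 0 = |x| := by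
  have hp0 : p ≠ 0 := by linarith
  rw [planeNorm, abs_zero, Real.zero_rpow hp0, add_zero, ← Real.rpow_mul (abs_nonneg _),
    mul_one_div_cancel hp0, Real.rpow_one]

theorem planeNorm_comm (x y : ℝ) : planeNorm p x y = planeNorm p y x := by
  rw [planeNorm, planeNorm, add_comm]

theorem abs_le_planeNorm (hp : 1 ≤ p) (x y : ℝ) : |x| ≤ planeNorm p x y := by
  rw [← planeNorm_zero_right hp x]
  unfold planeNorm
  rw [abs_zero, Real.zero_rpow (by linarith), add_zero]
  exact Real.rpow_le_rpow (by positivity) (by linarith [Real.rpow_nonneg (abs_nonneg y) p])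
    (by positivity)

theorem lpDist_eq {m n : ℕ} (s r : SpatialQL.Site m n) :
    SpatialQL.lpDist p s r = planeNorm p (((s.1 : ℕ) : ℝ) - ((r.1 : ℕ) : ℝ))
      (((s.2 : ℕ) : ℝ) - ((r.2 : ℕ) : ℝ)) := rfl

end PlaneNorm

/-! ### The `L_p` distance on a grid as a combination of cuts -/

section Interpolation

theorem sum_second_difference (G : ℕ → ℝ) (M : ℕ) :
    ∑ k ∈ Finset.range M, (G (k + 2) - 2 * G (k + 1) + G k) =
      (G (M + 1) - G M) - (G 1 - G 0) := by
  induction M with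
  | zero => simp
  | succ M ih => rw [Finset.sum_range_succ, ih]; ring

/-- Summation by parts: a sequence in terms of its second differences. -/
theorem eq_sum_second_difference (G : ℕ → ℝ) (M j : ℕ) (hj : j ≤ M + 1) :
    G j = ((M + 1) * G M - M * G (M + 1)) + (G 1 - G 0) * j +
      ∑ k ∈ Finset.range M, (G (k + 2) - 2 * G (k + 1) + G k) * max (j : ℝ) (k + 1) := by
  -- At the endpoint `j = M + 1` every maximum equals `M + 1` and the sum telescopes; the induction
  -- below needs this case separately.
  have last : ∀ M : ℕ, G (M + 1) = ((M + 1) * G M - M * G (M + 1)) + (G 1 - G 0) * (M + 1) +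
      ∑ k ∈ Finset.range M, (G (k + 2) - 2 * G (k + 1) + G k) * max ((M : ℝ) + 1) (k + 1) := by
    intro M
    have : ∀ k ∈ Finset.range M, (G (k + 2) - 2 * G (k + 1) + G k) * max ((M : ℝ) + 1) (k + 1)
        = (G (k + 2) - 2 * G (k + 1) + G k) * (M + 1) := by
      intro k hk
      have : (k : ℝ) < M := by exact_mod_cast Finset.mem_range.1 hk
      rw [max_eq_left (by linarith)]
    rw [Finset.sum_congr rfl this, ← Finset.sum_mul, sum_second_difference]
    ring
  induction M with
  | zero =>
    interval_cases j
    · simp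
    · simp
  | succ M ih =>
    rcases Nat.lt_or_ge j (M + 2) with h | h
    · rw [Finset.sum_range_succ, max_eq_right (by exact_mod_cast Nat.le_of_lt_succ h)]
      have := ih (by omega)
      push_cast
      linarith
    · obtain rfl : j = M + 1 + 1 := by omega
      have := last (M + 1)
      push_cast at this ⊢
      linarith

variable {p : ℝ}

/-- On integer vectors in a bounded region, the `L_p` norm of the plane is a nonnegative
combination of absolute values of linear forms with integer coefficients. -/
theorem planeNorm_eq_sum_abs (hp : 1 ≤ p) (m n : ℕ) :
    ∃ (L M : ℕ) (A B : ℝ) (c : ℕ → ℝ), 0 ≤ A ∧ 0 ≤ B ∧ (∀ k, 0 ≤ c k) ∧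
      ∀ x y : ℤ, x.natAbs ≤ m → y.natAbs ≤ n → planeNorm p x y =
        A * |(y : ℝ)| + B * |(x : ℝ)| + ∑ k ∈ Finset.range M,
          c k * (|(L : ℝ) * x - (k + 1) * y| + |(L : ℝ) * x + (k + 1) * y|) := by
  -- Every nonzero `|y| ≤ n` divides `n!`, so homogeneity moves `(|x|, |y|)` to an integer point
  -- `(j, L)` with `j ≤ m L = M`. The norm is thus determined off the axis `y = 0` by the convex
  -- sequence `G`.
  set L : ℕ := n.factorial with hL
  have hL0 : (0 : ℝ) < L := by exact_mod_cast n.factorial_pos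
  set G : ℕ → ℝ := fun k => planeNorm p k L with hG
  set M : ℕ := m * L with hM
  have hconv : ∀ k, 0 ≤ G (k + 2) - 2 * G (k + 1) + G k := by
    intro k
    have h := planeNorm_add_le hp (k + 2) L k L
    have h2 := planeNorm_mul hp 2 (k + 1) L
    rw [abs_two] at h2
    have : planeNorm p ((k : ℝ) + 2 + k) (L + L) = planeNorm p (2 * (k + 1)) (2 * L) := by
      congr 1 <;> ring
    simp only [hG]
    push_cast
    linarith
  have hslope : ∀ k, G (k + 1) ≤ G k + 1 := by
    intro k
    have h := planeNorm_add_le hp k L 1 0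
    rw [planeNorm_zero_right hp, abs_one, add_zero] at h
    simpa [hG] using h
  have hlow : ∀ k : ℕ, (k : ℝ) ≤ G k := fun k => by
    simpa using abs_le_planeNorm hp (k : ℝ) L
  have h01 : G 0 ≤ G 1 := by
    have h := abs_le_planeNorm hp (L : ℝ) 0
    have h' := abs_le_planeNorm hp (L : ℝ) 1
    rw [planeNorm_comm] at h'
    have h0 : G 0 = L := by
      simp only [hG]
      rw [Nat.cast_zero, planeNorm_comm, planeNorm_zero_right hp]; simp
    have h1 : G 1 = planeNorm p 1 L := by simp [hG]
    rw [h0, h1]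
    simpa using h'
  -- The term of index `M` has a kink beyond all `j ≤ M`, so off the axis it only adds a multiple of
  -- `|y|`, which `A` compensates. Its weight `e` makes the coefficients of `|x|` on the axis `y =
  -- 0` add up to 1.
  set e : ℝ := 1 - (G (M + 1) - G M) with he
  have he0 : 0 ≤ e := by have := hslope M; linarith
  set c : ℕ → ℝ := fun k => if k < M then (G (k + 2) - 2 * G (k + 1) + G k) / (2 * L)
    else e / (2 * L) with hc
  refine ⟨L, M + 1, (G (M + 1) - (M + 1)) / L, G 1 - G 0, c, ?_, ?_, ?_, ?_⟩
  · have := hlow (M + 1)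
    push_cast at this
    exact div_nonneg (by linarith) hL0.le
  · linarith
  · intro k
    simp only [hc]
    split_ifs
    · exact div_nonneg (hconv k) (by positivity)
    · exact div_nonneg he0 (by positivity)
  intro x y hx hy
  have hcM : ∀ g : ℕ → ℝ, ∑ k ∈ Finset.range (M + 1), c k * g k =
      (∑ k ∈ Finset.range M, (G (k + 2) - 2 * G (k + 1) + G k) * g k + e * g M) / (2 * L) := by
    intro g
    rw [Finset.sum_range_succ, add_div, Finset.sum_div]
    congr 1
    · refine Finset.sum_congr rfl fun k hk => ?_
      simp only [hc, if_pos (Finset.mem_range.1 hk)]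
      ring
    · simp only [hc, lt_irrefl, if_false]
      ring
  rw [hcM]
  rcases eq_or_ne y 0 with rfl | hy0
  · have hs := eq_sum_second_difference G (M + 1) 0 (by omega)
    simp only [Int.cast_zero, mul_zero, sub_zero, add_zero, abs_zero, zero_add]
    rw [planeNorm_zero_right hp, ← Finset.sum_mul, sum_second_difference, abs_mul, abs_of_pos hL0, he]
    field_simp
    ring
  · obtain ⟨q, hq⟩ : y.natAbs ∣ L := Nat.dvd_factorial (Int.natAbs_pos.2 hy0) hy
    set j : ℕ := x.natAbs * q with hj
    have hjM : j ≤ M := by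
      have hqL : q ≤ L := by
        rw [hq]; exact Nat.le_mul_of_pos_left q (Int.natAbs_pos.2 hy0)
      exact Nat.mul_le_mul hx hqL
    have hya : (0 : ℝ) < |(y : ℝ)| := abs_pos.2 (by exact_mod_cast hy0)
    have hcx : ((x.natAbs : ℕ) : ℝ) = |(x : ℝ)| := by rw [Nat.cast_natAbs, Int.cast_abs]
    have hcy : ((y.natAbs : ℕ) : ℝ) = |(y : ℝ)| := by rw [Nat.cast_natAbs, Int.cast_abs]
    have hLy : (L : ℝ) = |(y : ℝ)| * q := by rw [← hcy]; exact_mod_cast hq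
    have hjr : (j : ℝ) * |(y : ℝ)| = L * |(x : ℝ)| := by
      rw [hj, hLy]; push_cast; rw [hcx]; ring
    have hq0 : (0 : ℝ) < q := by
      by_contra h
      have : (q : ℝ) = 0 := le_antisymm (not_lt.1 h) (Nat.cast_nonneg q)
      rw [this, mul_zero] at hLy
      exact hL0.ne' hLy
    -- By `|a - b| + |a + b| = 2 max |a| |b|`, each pair of linear forms reproduces one kink of the
    -- summation by parts.
    have hmax : ∀ k : ℝ, 0 ≤ k → |(L : ℝ) * x - k * y| + |(L : ℝ) * x + k * y| =
        2 * |(y : ℝ)| * max (j : ℝ) k := by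
      intro k hk
      have h1 : ∀ a b : ℝ, |a - b| + |a + b| = 2 * max |a| |b| := by
        intro a b
        rcases abs_cases a with ⟨h, _⟩ | ⟨h, _⟩ <;> rcases abs_cases b with ⟨h', _⟩ | ⟨h', _⟩ <;>
        rcases abs_cases (a - b) with ⟨h2, _⟩ | ⟨h2, _⟩ <;>
        rcases abs_cases (a + b) with ⟨h3, _⟩ | ⟨h3, _⟩ <;>
        rcases max_cases |a| |b| with ⟨h4, _⟩ | ⟨h4, _⟩ <;> linarith
      rw [h1, abs_mul, abs_mul, abs_of_pos hL0, abs_of_nonneg hk, ← hjr, mul_assoc,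
        mul_max_of_nonneg _ _ hya.le, mul_comm (j : ℝ), mul_comm k]
    have hGj : planeNorm p x y * q = G j := by
      have : planeNorm p j L = planeNorm p (q * |(x : ℝ)|) (q * |(y : ℝ)|) := by
        congr 1
        · rw [hj]; push_cast; rw [hcx]; ring
        · rw [hLy]; ring
      simp only [hG]
      rw [this, planeNorm_mul hp, planeNorm_abs_abs, abs_of_pos hq0, mul_comm]
    have hs := eq_sum_second_difference G M j (by omega)
    have hsum : ∀ k ∈ Finset.range M, (G (k + 2) - 2 * G (k + 1) + G k) *
        (|(L : ℝ) * x - (k + 1) * y| + |(L : ℝ) * x + (k + 1) * y|) =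
        ((G (k + 2) - 2 * G (k + 1) + G k) * max (j : ℝ) (k + 1)) * (2 * |(y : ℝ)|) := by
      intro k _
      rw [hmax _ (by positivity)]; ring
    have hjx : |(x : ℝ)| = j * |(y : ℝ)| / L := by rw [hjr]; field_simp
    rw [Finset.sum_congr rfl hsum, ← Finset.sum_mul, hmax _ (by positivity),
      max_eq_right (by exact_mod_cast hjM.trans (Nat.le_succ M)), hjx]
    have hNx : planeNorm p x y = G j * |(y : ℝ)| / L := by
      rw [← hGj, hLy]; field_simp
    rw [hNx]
    field_simp
    rw [hs, he]
    ring

/-- Each linear form has integer coefficients, so its absolute value on `s - r` is a distance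
between integers, hence a cut semimetric. -/
theorem isCutSemimetric_lpDist (hp : 1 ≤ p) (m n : ℕ) :
    IsCutSemimetric (fun s r : SpatialQL.Site m n => SpatialQL.lpDist p s r) := by
  obtain ⟨L, M, A, B, c, hA, hB, hc, h⟩ := planeNorm_eq_sum_abs hp m n
  have key : ∀ s r : SpatialQL.Site m n, SpatialQL.lpDist p s r =
      A * |(((s.2 : ℕ) : ℤ) : ℝ) - (((r.2 : ℕ) : ℤ) : ℝ)| +
      B * |(((s.1 : ℕ) : ℤ) : ℝ) - (((r.1 : ℕ) : ℤ) : ℝ)| + ∑ k ∈ Finset.range M, c k *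
        (|(((L * (s.1 : ℕ) - (k + 1) * (s.2 : ℕ) : ℤ)) : ℝ) -
            ((L * (r.1 : ℕ) - (k + 1) * (r.2 : ℕ) : ℤ) : ℝ)| +
          |(((L * (s.1 : ℕ) + (k + 1) * (s.2 : ℕ) : ℤ)) : ℝ) -
            ((L * (r.1 : ℕ) + (k + 1) * (r.2 : ℕ) : ℤ) : ℝ)|) := by
    intro s r
    have := h ((s.1 : ℕ) - (r.1 : ℕ) : ℤ) ((s.2 : ℕ) - (r.2 : ℕ) : ℤ) (by omega) (by omega)
    rw [lpDist_eq]
    push_cast at this ⊢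
    rw [this]
    congr 1
    refine Finset.sum_congr rfl fun k _ => ?_
    congr 3 <;> ring
  have h2 := (((IsCutSemimetric.abs_sub_int
      (fun s : SpatialQL.Site m n => ((s.2 : ℕ) : ℤ))).const_mul hA).add
    ((IsCutSemimetric.abs_sub_int
      (fun s : SpatialQL.Site m n => ((s.1 : ℕ) : ℤ))).const_mul hB)).add
    (IsCutSemimetric.sum (Finset.range M) fun k _ =>
      ((IsCutSemimetric.abs_sub_int
        (fun s : SpatialQL.Site m n => (L * (s.1 : ℕ) - (k + 1) * (s.2 : ℕ) : ℤ))).add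
      (IsCutSemimetric.abs_sub_int
        (fun s : SpatialQL.Site m n => (L * (s.1 : ℕ) + (k + 1) * (s.2 : ℕ) : ℤ)))).const_mul
        (hc k))
  simpa only [key] using h2

end Interpolation

/-! ### Uniform lower bound for the correlation matrix -/

section CorrMatrix

theorem sum_pow_le_of_injOn {ι : Type*} (s : Finset ι) (f : ι → ℕ) (hf : Set.InjOn f s) {b : ℝ}
    (hb0 : 0 ≤ b) (hb1 : b < 1) : ∑ i ∈ s, b ^ f i ≤ (1 - b)⁻¹ := by
  classical
  rw [← Finset.sum_image (f := fun k => b ^ k) hf, ← tsum_geometric_of_lt_one hb0 hb1]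
  exact (summable_geometric_of_lt_one hb0 hb1).sum_le_tsum _ fun k _ => pow_nonneg hb0 k

/-- On either side of `i₀` each distance occurs at most once, giving two geometric series. -/
theorem sum_pow_natAbs_sub_le {m : ℕ} (i₀ : Fin m) {b : ℝ} (hb0 : 0 ≤ b) (hb1 : b < 1) :
    ∑ i : Fin m, b ^ ((i₀ : ℕ) - (i : ℕ) : ℤ).natAbs ≤ 2 * (1 - b)⁻¹ := by
  rw [← Finset.sum_filter_add_sum_filter_not Finset.univ (fun i : Fin m => i ≤ i₀), two_mul]
  refine add_le_add ?_ ?_ <;> refine sum_pow_le_of_injOn _ _ ?_ hb0 hb1 <;> intro i hi j hj h <;>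
    · simp only [Finset.coe_filter, Finset.mem_univ, true_and, Set.mem_ofPred_eq,
        Fin.le_def] at hi hj h
      ext
      omega

theorem exp_neg_le_one_sub {q b : ℝ} (hq0 : 0 ≤ q) (hqb : q ≤ b) (hb : b < 1) :
    Real.exp (-(q * (1 - b)⁻¹)) ≤ 1 - q := by
  have h1 : 0 < 1 - q := by linarith
  have h2 : q * (1 - q)⁻¹ ≤ q * (1 - b)⁻¹ :=
    mul_le_mul_of_nonneg_left (inv_anti₀ (by linarith) (by linarith)) hq0
  have h3 := Real.add_one_le_exp (q * (1 - q)⁻¹)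
  have h4 : q * (1 - q)⁻¹ + 1 = (1 - q)⁻¹ := by field_simp; ring
  rw [Real.exp_neg]
  refine inv_le_of_inv_le₀ h1 ?_
  rw [← h4]
  exact h3.trans (Real.exp_le_exp.2 h2)

variable {p ρ : ℝ}

theorem lpDist_self (hp : 1 ≤ p) {m n : ℕ} (s : SpatialQL.Site m n) :
    SpatialQL.lpDist p s s = 0 := by
  rw [lpDist_eq, sub_self, sub_self, planeNorm_zero_right hp, abs_zero]

theorem le_lpDist (hp : 1 ≤ p) {m n : ℕ} (s r : SpatialQL.Site m n) :
    ((((s.1 : ℕ) - (r.1 : ℕ) : ℤ).natAbs + ((s.2 : ℕ) - (r.2 : ℕ) : ℤ).natAbs : ℕ) : ℝ) ≤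
      2 * SpatialQL.lpDist p s r := by
  have h1 := abs_le_planeNorm hp (((s.1 : ℕ) : ℝ) - ((r.1 : ℕ) : ℝ))
      (((s.2 : ℕ) : ℝ) - ((r.2 : ℕ) : ℝ))
  have h2 := abs_le_planeNorm hp (((s.2 : ℕ) : ℝ) - ((r.2 : ℕ) : ℝ))
      (((s.1 : ℕ) : ℝ) - ((r.1 : ℕ) : ℝ))
  rw [planeNorm_comm] at h2
  rw [lpDist_eq, Nat.cast_add, Nat.cast_natAbs, Nat.cast_natAbs]
  push_cast
  linarith

theorem one_le_natAbs_add {m n : ℕ} {s r : SpatialQL.Site m n} (h : s ≠ r) :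
    1 ≤ ((s.1 : ℕ) - (r.1 : ℕ) : ℤ).natAbs + ((s.2 : ℕ) - (r.2 : ℕ) : ℤ).natAbs := by
  by_contra h'
  apply h
  ext <;> omega

/-- The kernel `ρ ^ d`, with `d` the `L_p` distance, is positive definite on grids, uniformly in
the size of the grid. -/
theorem exists_pos_le_sum_rpow_lpDist (hp : 1 ≤ p) (hρ0 : 0 ≤ ρ) (hρ1 : ρ < 1) :
    ∃ δ : ℝ, 0 < δ ∧ ∀ (m n : ℕ) (v : SpatialQL.Site m n → ℝ), δ * ∑ s, v s ^ 2 ≤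
      ∑ s, ∑ r, v s * v r * ρ ^ SpatialQL.lpDist p s r := by
  -- For `ρ = 0` the convention `0 ^ 0 = 1` makes the kernel the identity.
  rcases hρ0.eq_or_lt with rfl | hρ0
  · refine ⟨1, one_pos, fun m n v => le_of_eq ?_⟩
    rw [one_mul]
    refine Finset.sum_congr rfl fun s _ => ?_
    rw [Finset.sum_eq_single s, lpDist_self hp, Real.rpow_zero]
    · ring
    · intro r _ hr
      rw [Real.zero_rpow, mul_zero]
      intro h0
      have h1 := le_lpDist hp s r
      have h2 : (1 : ℝ) ≤ _ := Nat.one_le_cast.2 (one_le_natAbs_add hr.symm)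
      rw [h0] at h1
      linarith
    · simp
  -- Each coordinate difference is at most `d`, so `ρ ^ d ≤ b ^ (|Δx| + |Δy|)`, whose sum over the
  -- grid factors into two geometric sums bounded together by `C`.
  set b : ℝ := ρ ^ (1 / 2 : ℝ) with hb
  have hb0 : 0 < b := Real.rpow_pos_of_pos hρ0 _
  have hb1 : b < 1 := Real.rpow_lt_one hρ0.le hρ1 (by norm_num)
  set C : ℝ := (2 * (1 - b)⁻¹) * (2 * (1 - b)⁻¹) with hC
  refine ⟨Real.exp (-(C * (1 - b)⁻¹)), Real.exp_pos _, fun m n v => ?_⟩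
  have hlog : 0 ≤ -Real.log ρ := by have := Real.log_neg hρ0 hρ1; linarith
  have hexp : ∀ s r : SpatialQL.Site m n, Real.exp (-(-Real.log ρ * SpatialQL.lpDist p s r)) =
      ρ ^ SpatialQL.lpDist p s r := by
    intro s r
    rw [Real.rpow_def_of_pos hρ0]
    congr 1
    ring
  have h := ((isCutSemimetric_lpDist hp m n).const_mul hlog).sum_exp_neg_ge v
  simp only [hexp] at h
  refine le_trans ?_ h
  rw [Finset.mul_sum]
  refine Finset.sum_le_sum fun s _ => mul_le_mul_of_nonneg_right ?_ (sq_nonneg _)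
  have hpow : ∀ r : SpatialQL.Site m n, ρ ^ SpatialQL.lpDist p s r ≤
      b ^ (((s.1 : ℕ) - (r.1 : ℕ) : ℤ).natAbs + ((s.2 : ℕ) - (r.2 : ℕ) : ℤ).natAbs) := by
    intro r
    rw [hb, ← Real.rpow_natCast, ← Real.rpow_mul hρ0.le]
    refine Real.rpow_le_rpow_of_exponent_ge hρ0 hρ1.le ?_
    linarith [le_lpDist hp s r]
  have hfac : ∀ r ∈ Finset.univ.erase s,
      Real.exp (-(ρ ^ SpatialQL.lpDist p s r * (1 - b)⁻¹)) ≤ 1 - ρ ^ SpatialQL.lpDist p s r := by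
    intro r hr
    refine exp_neg_le_one_sub (Real.rpow_nonneg hρ0.le _) ((hpow r).trans ?_) hb1
    refine (pow_le_pow_of_le_one hb0.le hb1.le
      (one_le_natAbs_add (Finset.ne_of_mem_erase hr).symm)).trans_eq (pow_one b)
  refine le_trans ?_ (Finset.prod_le_prod (fun r _ => (Real.exp_pos _).le) hfac)
  rw [← Real.exp_sum, Finset.sum_neg_distrib, ← Finset.sum_mul]
  refine Real.exp_le_exp.2 (neg_le_neg
    (mul_le_mul_of_nonneg_right ?_ (inv_nonneg.2 (by linarith))))
  calc _ ≤ ∑ r, ρ ^ SpatialQL.lpDist p s r :=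
        Finset.sum_le_sum_of_subset_of_nonneg (Finset.erase_subset _ _)
          fun r _ _ => Real.rpow_nonneg hρ0.le _
    _ ≤ ∑ r : SpatialQL.Site m n, b ^ ((s.1 : ℕ) - (r.1 : ℕ) : ℤ).natAbs *
          b ^ ((s.2 : ℕ) - (r.2 : ℕ) : ℤ).natAbs :=
        Finset.sum_le_sum fun r _ => (hpow r).trans_eq (pow_add _ _ _)
    _ = (∑ i : Fin m, b ^ ((s.1 : ℕ) - (i : ℕ) : ℤ).natAbs) *
          ∑ j : Fin n, b ^ ((s.2 : ℕ) - (j : ℕ) : ℤ).natAbs := by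
        rw [Fintype.sum_prod_type, Finset.sum_mul_sum]
    _ ≤ C := mul_le_mul (sum_pow_natAbs_sub_le _ hb0.le hb1) (sum_pow_natAbs_sub_le _ hb0.le hb1)
        (Finset.sum_nonneg fun _ _ => pow_nonneg hb0.le _)
        (mul_nonneg zero_le_two (inv_nonneg.2 (by linarith)))

/-- The correlation matrix is positive definite, uniformly in the size of the grid. -/
theorem exists_pos_le_corrMatrix {a : ℝ} (hp : 1 ≤ p) (ha0 : 0 < a) (ha1 : a ≤ 1) (hρ0 : 0 ≤ ρ)
    (hρ1 : ρ ≤ 1) (hns : ¬ (a = 1 ∧ ρ = 1)) :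
    ∃ δ : ℝ, 0 < δ ∧ ∀ (m n : ℕ) (v : SpatialQL.Site m n → ℝ), δ * (v ⬝ᵥ v) ≤
      v ⬝ᵥ (SpatialQL.corrMatrix a ρ p m n *ᵥ v) := by
  have hΓ : ∀ (m n : ℕ) (v : SpatialQL.Site m n → ℝ),
      v ⬝ᵥ (SpatialQL.corrMatrix a ρ p m n *ᵥ v) = (1 - a) * ∑ s, v s ^ 2 +
        a * ∑ s, ∑ r, v s * v r * ρ ^ SpatialQL.lpDist p s r := by
    intro m n v
    simp only [dotProduct, Matrix.mulVec, SpatialQL.corrMatrix, Matrix.of_apply, Finset.mul_sum,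
      ← Finset.sum_add_distrib]
    refine Finset.sum_congr rfl fun s _ => ?_
    have : ∀ r, v s * ((if s = r then 1 else a * ρ ^ SpatialQL.lpDist p s r) * v r) =
        (if s = r then (1 - a) * v s ^ 2 else 0) +
          a * (v s * v r * ρ ^ SpatialQL.lpDist p s r) := by
      intro r
      split_ifs with h
      · subst h
        rw [lpDist_self hp, Real.rpow_zero]
        ring
      · ring
    rw [Finset.sum_congr rfl fun r _ => this r, Finset.sum_add_distrib]
    simp
  have hvv : ∀ (m n : ℕ) (v : SpatialQL.Site m n → ℝ), v ⬝ᵥ v = ∑ s, v s ^ 2 := by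
    intro m n v
    simp only [dotProduct, sq]
  simp only [hΓ, hvv]
  -- `Γ` is `(1 - a) I` plus `a` times the kernel. The kernel gives the bound when `ρ < 1`; for `ρ =
  -- 1` it is only semidefinite, and `1 - a > 0`.
  rcases hρ1.lt_or_eq with h | rfl
  · obtain ⟨δ, hδ, H⟩ := exists_pos_le_sum_rpow_lpDist hp hρ0 h
    refine ⟨a * δ, mul_pos ha0 hδ, fun m n v => ?_⟩
    have h1 := mul_le_mul_of_nonneg_left (H m n v) ha0.le
    have h2 : 0 ≤ (1 - a) * ∑ s, v s ^ 2 :=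
      mul_nonneg (by linarith) (Finset.sum_nonneg fun s _ => sq_nonneg _)
    rw [mul_assoc]
    linarith
  · have ha : a < 1 := lt_of_le_of_ne ha1 fun h => hns ⟨h, rfl⟩
    refine ⟨1 - a, by linarith, fun m n v => ?_⟩
    simp only [Real.one_rpow, mul_one, ← Finset.sum_mul_sum]
    have := mul_nonneg ha0.le (mul_self_nonneg (∑ s, v s))
    linarith

end CorrMatrix

/-! ### Bilinear forms in the inverse matrix -/

section InverseBound

variable {ι : Type*} [Fintype ι] [DecidableEq ι] {Γ : Matrix ι ι ℝ} {δ : ℝ}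

theorem isUnit_det_of_quadratic_bound (hδ : 0 < δ) (hΓ : ∀ v : ι → ℝ, δ * (v ⬝ᵥ v) ≤ v ⬝ᵥ (Γ *ᵥ v)) :
    IsUnit Γ.det := by
  rw [← Matrix.isUnit_iff_isUnit_det, ← Matrix.mulVec_injective_iff_isUnit]
  intro v w hvw
  have h1 : Γ *ᵥ (v - w) = 0 := by rw [Matrix.mulVec_sub]; exact sub_eq_zero.2 hvw
  have h2 := hΓ (v - w)
  rw [h1, dotProduct_zero] at h2
  have h3 : 0 ≤ (v - w) ⬝ᵥ (v - w) := Finset.sum_nonneg fun i _ => mul_self_nonneg _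
  have h4 : (v - w) ⬝ᵥ (v - w) = 0 := le_antisymm (by nlinarith) h3
  exact sub_eq_zero.1 (dotProduct_self_eq_zero.1 h4)

/-- With `z = Γ⁻¹ y`, Cauchy–Schwarz in `δ (z ⬝ᵥ z) ≤ z ⬝ᵥ y` yields `‖Γ⁻¹‖ ≤ 1/δ`, without symmetry
of `Γ`. Entrywise bounds cost one factor `√N` per vector. -/
theorem abs_dotProduct_inv_mulVec_le (hδ : 0 < δ)
    (hΓ : ∀ v : ι → ℝ, δ * (v ⬝ᵥ v) ≤ v ⬝ᵥ (Γ *ᵥ v)) {x y : ι → ℝ} {X Y : ℝ}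
    (hx : ∀ i, |x i| ≤ X) (hy : ∀ i, |y i| ≤ Y) (hX : 0 ≤ X) (hY : 0 ≤ Y) :
    |x ⬝ᵥ (Γ⁻¹ *ᵥ y)| ≤ Fintype.card ι * (δ⁻¹ * X * Y) := by
  have hdet := isUnit_det_of_quadratic_bound hδ hΓ
  set z := Γ⁻¹ *ᵥ y with hz
  have hΓz : Γ *ᵥ z = y := by
    rw [hz, Matrix.mulVec_mulVec, Matrix.mul_nonsing_inv _ hdet, Matrix.one_mulVec]
  have cs : ∀ a b : ι → ℝ, (a ⬝ᵥ b) ^ 2 ≤ (a ⬝ᵥ a) * (b ⬝ᵥ b) := by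
    intro a b
    simpa [dotProduct, sq] using Finset.sum_mul_sq_le_sq_mul_sq Finset.univ a b
  have nn : ∀ a : ι → ℝ, 0 ≤ a ⬝ᵥ a := fun a => Finset.sum_nonneg fun i _ => mul_self_nonneg _
  have bd : ∀ (a : ι → ℝ) (A : ℝ), (∀ i, |a i| ≤ A) → a ⬝ᵥ a ≤ Fintype.card ι * A ^ 2 := by
    intro a A h
    have : ∀ i ∈ Finset.univ, a i * a i ≤ A ^ 2 := fun i _ => by
      rw [← sq, ← sq_abs]
      exact pow_le_pow_left₀ (abs_nonneg _) (h i) 2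
    simpa [dotProduct] using Finset.sum_le_card_nsmul _ _ _ this
  have h1 := hΓ z
  rw [hΓz] at h1
  have h2 : δ ^ 2 * (z ⬝ᵥ z) ≤ y ⬝ᵥ y := by
    have h3 := cs z y
    have h4 : (δ * (z ⬝ᵥ z)) ^ 2 ≤ (z ⬝ᵥ z) * (y ⬝ᵥ y) :=
      (pow_le_pow_left₀ (mul_nonneg hδ.le (nn z)) h1 2).trans h3
    rcases (nn z).eq_or_lt with h0 | h0
    · rw [← h0, mul_zero]; exact nn y
    · refine le_of_mul_le_mul_left ?_ h0
      linarith
  have h5 : z ⬝ᵥ z ≤ (δ⁻¹) ^ 2 * (Fintype.card ι * Y ^ 2) := by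
    rw [inv_pow, ← div_eq_inv_mul, le_div_iff₀ (by positivity)]
    linarith [bd y Y hy]
  refine abs_le_of_sq_le_sq ?_ (by positivity)
  calc (x ⬝ᵥ z) ^ 2 ≤ (x ⬝ᵥ x) * (z ⬝ᵥ z) := cs x z
    _ ≤ (Fintype.card ι * X ^ 2) * ((δ⁻¹) ^ 2 * (Fintype.card ι * Y ^ 2)) :=
      mul_le_mul (bd x X hx) h5 (nn z) (by positivity)
    _ = _ := by ring

theorem abs_dotProduct_inv_mulVec_sub_le (hδ : 0 < δ)
    (hΓ : ∀ v : ι → ℝ, δ * (v ⬝ᵥ v) ≤ v ⬝ᵥ (Γ *ᵥ v)) {x y x' y' : ι → ℝ} {X Y X' Y' : ℝ}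
    (hx : ∀ i, |x i| ≤ X) (hy : ∀ i, |y' i| ≤ Y) (hxx : ∀ i, |x i - x' i| ≤ X')
    (hyy : ∀ i, |y i - y' i| ≤ Y') (hX : 0 ≤ X) (hY : 0 ≤ Y) (hX' : 0 ≤ X') (hY' : 0 ≤ Y') :
    |x ⬝ᵥ (Γ⁻¹ *ᵥ y) - x' ⬝ᵥ (Γ⁻¹ *ᵥ y')| ≤ Fintype.card ι * (δ⁻¹ * (X * Y' + X' * Y)) := by
  have h : x ⬝ᵥ (Γ⁻¹ *ᵥ y) - x' ⬝ᵥ (Γ⁻¹ *ᵥ y') =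
      x ⬝ᵥ (Γ⁻¹ *ᵥ (y - y')) + (x - x') ⬝ᵥ (Γ⁻¹ *ᵥ y') := by
    rw [Matrix.mulVec_sub, dotProduct_sub, sub_dotProduct]
    ring
  rw [h]
  refine (abs_add_le _ _).trans ?_
  have h1 := abs_dotProduct_inv_mulVec_le hδ hΓ hx (y := y - y') hyy hX hY'
  have h2 := abs_dotProduct_inv_mulVec_le hδ hΓ (x := x - x') hxx hy hX' hY
  refine (add_le_add h1 h2).trans_eq ?_
  ring

end InverseBound

/-! ### The quasi-score, its derivative and uniform bounds -/

/-- Uniform bounds on a bounded interval for a `C²` function and its derivative. -/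
theorem ContDiff.exists_bounds {f : ℝ → ℝ} (hf : ContDiff ℝ 2 f) (R : ℝ) :
    ∃ C : ℝ, 0 ≤ C ∧ ∀ x, |x| ≤ R → |f x| ≤ C ∧ |deriv f x| ≤ C ∧
      ∀ y, |y| ≤ R → |f x - f y| ≤ C * |x - y| ∧ |deriv f x - deriv f y| ≤ C * |x - y| := by
  have hd : ContDiff ℝ 1 (deriv f) := by
    have : ContDiff ℝ (1 + 1) f := by convert hf using 1; norm_num
    exact (contDiff_succ_iff_deriv.1 this).2.2
  have hdd : Continuous (deriv (deriv f)) := hd.continuous_deriv le_rfl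
  have hbd : ∀ g : ℝ → ℝ, Continuous g → ∃ C, ∀ x, |x| ≤ R → |g x| ≤ C := by
    intro g hg
    obtain ⟨C, hC⟩ := (isCompact_Icc (a := -R) (b := R)).exists_bound_of_continuousOn
      hg.continuousOn
    exact ⟨C, fun x hx => hC x (abs_le.1 hx)⟩
  obtain ⟨C0, h0⟩ := hbd f hf.continuous
  obtain ⟨C1, h1⟩ := hbd _ hd.continuous
  obtain ⟨C2, h2⟩ := hbd _ hdd
  have lip : ∀ (g : ℝ → ℝ) (C : ℝ), Differentiable ℝ g → (∀ x, |x| ≤ R → |deriv g x| ≤ C) →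
      ∀ x y, |x| ≤ R → |y| ≤ R → |g x - g y| ≤ C * |x - y| := by
    intro g C hg hC x y hx hy
    exact (convex_Icc (-R) R).norm_image_sub_le_of_norm_deriv_le (f := g)
      (fun z _ => hg z) (fun z hz => hC z (abs_le.2 hz)) (abs_le.1 hy) (abs_le.1 hx)
  refine ⟨max 0 (max C0 (max C1 C2)), le_max_left _ _, fun x hx => ⟨?_, ?_, fun y hy => ⟨?_, ?_⟩⟩⟩
  · exact (h0 x hx).trans (by simp)
  · exact (h1 x hx).trans (by simp)
  · refine (lip f C1 (hf.differentiable (by norm_num)) h1 x y hx hy).trans ?_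
    exact mul_le_mul_of_nonneg_right (by simp) (abs_nonneg _)
  · refine (lip _ C2 (hd.differentiable (by norm_num)) h2 x y hx hy).trans ?_
    exact mul_le_mul_of_nonneg_right (by simp) (abs_nonneg _)

namespace SpatialQL

noncomputable section

/-- The standard deviation `√(θ (1 - θ))` as a function of the linear predictor. -/
def respSD (η : ℝ) : ℝ := (Real.exp (η / 2) + Real.exp (-(η / 2)))⁻¹

/-- The standardized residual `(y - θ) / √(θ (1 - θ))` as a function of the linear predictor. -/
def stdResid (y η : ℝ) : ℝ := y * Real.exp (-(η / 2)) + (y - 1) * Real.exp (η / 2)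

theorem respSD_pos (η : ℝ) : 0 < respSD η := by unfold respSD; positivity

theorem respSD_le_one (η : ℝ) : respSD η ≤ 1 := by
  refine inv_le_one_of_one_le₀ ?_
  rcases le_total 0 η with h | h
  · linarith [Real.one_le_exp (show 0 ≤ η / 2 by linarith), Real.exp_pos (-(η / 2))]
  · linarith [Real.one_le_exp (show 0 ≤ -(η / 2) by linarith), Real.exp_pos (η / 2)]

theorem contDiff_respSD : ContDiff ℝ 2 respSD := by
  unfold respSD
  refine ContDiff.inv (by fun_prop) fun η => ?_
  positivity

theorem contDiff_stdResid (y : ℝ) : ContDiff ℝ 2 (stdResid y) := by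
  unfold stdResid
  fun_prop

theorem logistic_variance (η : ℝ) :
    Real.exp η / (1 + Real.exp η) * (1 - Real.exp η / (1 + Real.exp η)) = respSD η ^ 2 := by
  have h : Real.exp η = Real.exp (η / 2) ^ 2 := by rw [← Real.exp_nat_mul]; congr 1; norm_num; ring
  rw [respSD, Real.exp_neg, h]
  have := Real.exp_pos (η / 2)
  field_simp
  ring

theorem stdResid_eq (y η : ℝ) :
    stdResid y η = (respSD η)⁻¹ * (y - Real.exp η / (1 + Real.exp η)) := by
  have h : Real.exp η = Real.exp (η / 2) ^ 2 := by rw [← Real.exp_nat_mul]; congr 1; norm_num; ring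
  rw [stdResid, respSD, Real.exp_neg, h]
  have := Real.exp_pos (η / 2)
  field_simp
  ring

section Score

variable {u m n : ℕ}

/-- The linear predictor `t_sᵀ β`. -/
def linPred (t : Site m n → Fin (u + 1) → ℝ) (β : Param u) (s : Site m n) : ℝ := ∑ j, t s j * β j

/-- The component of the quasi-score in the direction `w`. -/
def scoreForm (Γ : Matrix (Site m n) (Site m n) ℝ) (t : Site m n → Fin (u + 1) → ℝ)
    (y : Site m n → ℝ) (β w : Param u) : ℝ :=
  (fun s => linPred t w s * respSD (linPred t β s)) ⬝ᵥ
    (Γ⁻¹ *ᵥ fun r => stdResid (y r) (linPred t β r))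

/-- The derivative of `scoreForm` in the direction `v`. -/
def scoreDeriv (Γ : Matrix (Site m n) (Site m n) ℝ) (t : Site m n → Fin (u + 1) → ℝ)
    (y : Site m n → ℝ) (β w v : Param u) : ℝ :=
  (fun s => linPred t w s * (linPred t v s * deriv respSD (linPred t β s))) ⬝ᵥ
    (Γ⁻¹ *ᵥ fun r => stdResid (y r) (linPred t β r)) +
  (fun s => linPred t w s * respSD (linPred t β s)) ⬝ᵥ
    (Γ⁻¹ *ᵥ fun r => linPred t v r * deriv (stdResid (y r)) (linPred t β r))

variable {Γ : Matrix (Site m n) (Site m n) ℝ} {t : Site m n → Fin (u + 1) → ℝ}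
  {y : Site m n → ℝ}

theorem linPred_add_smul (β v : Param u) (τ : ℝ) (s : Site m n) :
    linPred t (β + τ • v) s = linPred t β s + τ * linPred t v s := by
  simp only [linPred, PiLp.add_apply, PiLp.smul_apply, smul_eq_mul, mul_add,
    Finset.sum_add_distrib, Finset.mul_sum]
  congr 1
  exact Finset.sum_congr rfl fun j _ => by ring

theorem linPred_sub (β v : Param u) (s : Site m n) :
    linPred t (β - v) s = linPred t β s - linPred t v s := by
  simp only [linPred, PiLp.sub_apply, mul_sub, Finset.sum_sub_distrib]

theorem abs_linPred_le (ht : ∀ s j, t s j = 0 ∨ t s j = 1) (w : Param u) (s : Site m n) :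
    |linPred t w s| ≤ (u + 1) * ‖w‖ := by
  have h : ∀ j ∈ Finset.univ, |t s j * w j| ≤ ‖w‖ := by
    intro j _
    have := PiLp.norm_apply_le w j
    rw [Real.norm_eq_abs] at this
    rcases ht s j with h | h <;> simp [h, this]
  refine (Finset.abs_sum_le_sum_abs _ _).trans ((Finset.sum_le_card_nsmul _ _ _ h).trans_eq ?_)
  simp

theorem meanResp_eq (β : Param u) (s : Site m n) :
    meanResp t β s = Real.exp (linPred t β s) / (1 + Real.exp (linPred t β s)) := rfl

theorem meanResp_variance (β : Param u) (s : Site m n) :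
    meanResp t β s * (1 - meanResp t β s) = respSD (linPred t β s) ^ 2 :=
  logistic_variance _

/-- Factoring `V = diag(σ) Γ diag(σ)` removes `β` from the inverse: one `σ⁻¹` standardizes the
residual, the other reduces `σ²` in `P` to `σ`. -/
theorem quasiScore_apply (hΓ : IsUnit Γ.det) (β : Param u) (j : Fin (u + 1)) :
    quasiScore Γ t y β j = (fun s => t s j * respSD (linPred t β s)) ⬝ᵥ
      (Γ⁻¹ *ᵥ fun r => stdResid (y r) (linPred t β r)) := by
  set σ : Site m n → ℝ := fun s => respSD (linPred t β s) with hσ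
  have hσ0 : ∀ s, σ s ≠ 0 := fun s => (respSD_pos _).ne'
  have hsqrt : ∀ s, Real.sqrt (meanResp t β s * (1 - meanResp t β s)) = σ s := fun s => by
    rw [meanResp_variance, Real.sqrt_sq (respSD_pos _).le]
  have hV : covMatrix Γ t β = Matrix.diagonal σ * Γ * Matrix.diagonal σ := by
    ext s r
    simp only [covMatrix, Matrix.of_apply, Matrix.mul_diagonal, Matrix.diagonal_mul, hsqrt]
    ring
  have hD : Matrix.diagonal σ * Matrix.diagonal (fun s => (σ s)⁻¹) = 1 := by
    rw [Matrix.diagonal_mul_diagonal, ← Matrix.diagonal_one]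
    congr 1
    funext s
    exact mul_inv_cancel₀ (hσ0 s)
  have hVinv : (covMatrix Γ t β)⁻¹ =
      Matrix.diagonal (fun s => (σ s)⁻¹) * (Γ⁻¹ * Matrix.diagonal fun s => (σ s)⁻¹) := by
    refine Matrix.inv_eq_right_inv ?_
    rw [hV, Matrix.mul_assoc, ← Matrix.mul_assoc (Matrix.diagonal σ) (Matrix.diagonal _), hD,
      Matrix.one_mul, Matrix.mul_assoc, ← Matrix.mul_assoc Γ, Matrix.mul_nonsing_inv _ hΓ,
      Matrix.one_mul, hD]
  have hz : (Matrix.diagonal (fun s => (σ s)⁻¹) *ᵥ fun s => y s - meanResp t β s) =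
      fun r => stdResid (y r) (linPred t β r) := by
    funext s
    rw [Matrix.mulVec_diagonal, stdResid_eq]
    rfl
  simp only [quasiScore]
  rw [hVinv, ← Matrix.mulVec_mulVec, ← Matrix.mulVec_mulVec, hz]
  simp only [Matrix.mulVec, dotProduct, Matrix.transpose_apply, derivMatrix, Matrix.of_apply,
    meanResp_variance]
  refine Finset.sum_congr rfl fun s _ => ?_
  have h := Matrix.mulVec_diagonal (fun s => (σ s)⁻¹)
    (fun s => ∑ r, Γ⁻¹ s r * stdResid (y r) (linPred t β r)) s
  simp only [Matrix.mulVec, dotProduct] at h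
  rw [h]
  have := hσ0 s
  simp only [hσ] at this ⊢
  field_simp

theorem inner_quasiScore (hΓ : IsUnit Γ.det) (β w : Param u) :
    inner ℝ w (quasiScore Γ t y β) = scoreForm Γ t y β w := by
  simp only [PiLp.inner_apply, quasiScore_apply hΓ, scoreForm, dotProduct, linPred,
    RCLike.inner_apply, conj_trivial, Finset.sum_mul]
  rw [Finset.sum_comm]
  refine Finset.sum_congr rfl fun s _ => Finset.sum_congr rfl fun j _ => ?_
  ring

theorem hasDerivAt_scoreForm (β w v : Param u) (τ : ℝ) :
    HasDerivAt (fun τ : ℝ => scoreForm Γ t y (β + τ • v) w)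
      (scoreDeriv Γ t y (β + τ • v) w v) τ := by
  have hlin : ∀ s, HasDerivAt (fun τ : ℝ => linPred t (β + τ • v) s) (linPred t v s) τ := by
    intro s
    simp only [linPred_add_smul]
    simpa using ((hasDerivAt_id τ).mul_const (linPred t v s)).const_add (linPred t β s)
  have hf : ∀ s, HasDerivAt (fun τ : ℝ => linPred t w s * respSD (linPred t (β + τ • v) s))
      (linPred t w s * (linPred t v s * deriv respSD (linPred t (β + τ • v) s))) τ := by
    intro s
    have h := (contDiff_respSD.differentiable (by norm_num)
      (linPred t (β + τ • v) s)).hasDerivAt.comp τ (hlin s)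
    rw [mul_comm (linPred t v s)]
    exact h.const_mul _
  have hg : ∀ r, HasDerivAt (fun τ : ℝ => stdResid (y r) (linPred t (β + τ • v) r))
      (linPred t v r * deriv (stdResid (y r)) (linPred t (β + τ • v) r)) τ := by
    intro r
    have h := ((contDiff_stdResid (y r)).differentiable (by norm_num)
      (linPred t (β + τ • v) r)).hasDerivAt.comp τ (hlin r)
    rw [mul_comm (linPred t v r)]
    exact h
  have := HasDerivAt.fun_sum (u := Finset.univ) fun s _ =>
    (hf s).mul (HasDerivAt.fun_sum (u := Finset.univ) fun r _ => (hg r).const_mul (Γ⁻¹ s r))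
  unfold scoreForm scoreDeriv dotProduct Matrix.mulVec dotProduct
  rw [← Finset.sum_add_distrib]
  exact this

theorem differentiable_quasiScore (hΓ : IsUnit Γ.det) : Differentiable ℝ (quasiScore Γ t y) := by
  rw [differentiable_euclidean]
  intro j
  simp only [quasiScore_apply hΓ, dotProduct, Matrix.mulVec]
  have hlin : ∀ s, Differentiable ℝ (fun β : Param u => linPred t β s) := by
    intro s
    unfold linPred
    fun_prop
  have hf : ∀ s, Differentiable ℝ (fun β : Param u => respSD (linPred t β s)) := fun s =>
    (contDiff_respSD.differentiable (by norm_num)).comp (hlin s)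
  have hg : ∀ r, Differentiable ℝ (fun β : Param u => stdResid (y r) (linPred t β r)) := fun r =>
    ((contDiff_stdResid (y r)).differentiable (by norm_num)).comp (hlin r)
  fun_prop

theorem inner_fderiv_quasiScore (hΓ : IsUnit Γ.det) (β w v : Param u) :
    inner ℝ w (fderiv ℝ (quasiScore Γ t y) β v) = scoreDeriv Γ t y β w v := by
  have h1 := hasDerivAt_scoreForm (Γ := Γ) (t := t) (y := y) β w v 0
  simp only [← inner_quasiScore hΓ, zero_smul, add_zero] at h1
  have h2 : HasDerivAt (fun τ : ℝ => β + τ • v) v 0 := by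
    simpa using ((hasDerivAt_id (0 : ℝ)).smul_const v).const_add β
  have h3 : HasFDerivAt (quasiScore Γ t y) (fderiv ℝ (quasiScore Γ t y) β) (β + (0 : ℝ) • v) := by
    simpa using (differentiable_quasiScore hΓ β).hasFDerivAt
  have h4 := (innerSL ℝ w).hasFDerivAt.comp_hasDerivAt (0 : ℝ) (h3.comp_hasDerivAt (0 : ℝ) h2)
  exact h4.unique h1

end Score

/-- Bounds for the derivative of the quasi-score near `β₀` and for its modulus of continuity,
proportional to the number of sites and otherwise uniform. -/
theorem exists_scoreDeriv_bounds {u : ℕ} (β₀ : Param u) {δ : ℝ} (hδ : 0 < δ) :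
    ∃ K : ℝ, 0 < K ∧ ∀ (m n : ℕ) (Γ : Matrix (Site m n) (Site m n) ℝ)
      (_ : ∀ v : Site m n → ℝ, δ * (v ⬝ᵥ v) ≤ v ⬝ᵥ (Γ *ᵥ v))
      (t : Site m n → Fin (u + 1) → ℝ) (_ : ∀ s j, t s j = 0 ∨ t s j = 1)
      (y : Site m n → ℝ) (_ : ∀ s, y s = 0 ∨ y s = 1) (β w v : Param u) (_ : ‖β - β₀‖ ≤ 1),
      |scoreDeriv Γ t y β w v| ≤ ((m * n : ℕ) : ℝ) * (K * ‖w‖ * ‖v‖) ∧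
      |scoreDeriv Γ t y β w v - scoreDeriv Γ t y β₀ w v| ≤
        ((m * n : ℕ) : ℝ) * (K * ‖β - β₀‖ * ‖w‖ * ‖v‖) := by
  -- `R` bounds the linear predictors on the unit ball about `β₀`, whatever the 0-1 covariates.
  set k : ℝ := (u : ℝ) + 1 with hk
  have hk0 : 0 ≤ k := by positivity
  set R : ℝ := k * (‖β₀‖ + 1) with hR
  obtain ⟨C1, hC1, h1⟩ := contDiff_respSD.exists_bounds R
  obtain ⟨C2, hC2, h2⟩ := (contDiff_stdResid 0).exists_bounds R
  obtain ⟨C3, hC3, h3⟩ := (contDiff_stdResid 1).exists_bounds R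
  set D : ℝ := C2 + C3 with hD
  have hD0 : 0 ≤ D := add_nonneg hC2 hC3
  have h4 : ∀ y : ℝ, (y = 0 ∨ y = 1) → ∀ x, |x| ≤ R → |stdResid y x| ≤ D ∧
      |deriv (stdResid y) x| ≤ D ∧ ∀ z, |z| ≤ R → |stdResid y x - stdResid y z| ≤ D * |x - z| ∧
        |deriv (stdResid y) x - deriv (stdResid y) z| ≤ D * |x - z| := by
    rintro y (rfl | rfl) x hx
    · obtain ⟨a, b, c⟩ := h2 x hx
      refine ⟨by linarith, by linarith, fun z hz => ⟨(c z hz).1.trans ?_, (c z hz).2.trans ?_⟩⟩ <;>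
        exact mul_le_mul_of_nonneg_right (by linarith) (abs_nonneg _)
    · obtain ⟨a, b, c⟩ := h3 x hx
      refine ⟨by linarith, by linarith, fun z hz => ⟨(c z hz).1.trans ?_, (c z hz).2.trans ?_⟩⟩ <;>
        exact mul_le_mul_of_nonneg_right (by linarith) (abs_nonneg _)
  -- The first summand bounds the two terms of the derivative, the second the four terms of its
  -- increment; the `1` ensures positivity.
  refine ⟨δ⁻¹ * (2 * (k ^ 2 * (C1 * D)) + 4 * (k ^ 3 * (C1 * D))) + 1, by positivity, ?_⟩
  intro m n Γ hΓ t ht y hy β w v hβ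
  have hcard : (Fintype.card (Site m n) : ℝ) = ((m * n : ℕ) : ℝ) := by simp
  have hw := abs_linPred_le ht w
  have hv := abs_linPred_le ht v
  have hd : ∀ s, |linPred t β s - linPred t β₀ s| ≤ k * ‖β - β₀‖ := fun s => by
    rw [← linPred_sub]; exact abs_linPred_le ht _ s
  have hl0 : ∀ s, |linPred t β₀ s| ≤ R := fun s =>
    (abs_linPred_le ht _ s).trans (mul_le_mul_of_nonneg_left (by linarith) hk0)
  have hl : ∀ s, |linPred t β s| ≤ R := fun s => by
    refine (abs_linPred_le ht _ s).trans (mul_le_mul_of_nonneg_left ?_ hk0)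
    have := norm_add_le (β - β₀) β₀
    rw [sub_add_cancel] at this
    linarith
  set N : ℝ := ((m * n : ℕ) : ℝ) with hN
  have hN0 : 0 ≤ N := Nat.cast_nonneg _
  set W := ‖w‖ with hW
  set V := ‖v‖ with hV
  set E := ‖β - β₀‖ with hE
  have hW0 : 0 ≤ W := norm_nonneg _
  have hV0 : 0 ≤ V := norm_nonneg _
  have hE0 : 0 ≤ E := norm_nonneg _
  -- entrywise bounds for the four vectors
  have a1 : ∀ s, |linPred t w s * (linPred t v s * deriv respSD (linPred t β s))| ≤
      k * W * (k * V * C1) := fun s => by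
    rw [abs_mul, abs_mul]
    have := (h1 _ (hl s)).2.1
    gcongr
    exacts [hw s, hv s]
  have a2 : ∀ s, |linPred t w s * respSD (linPred t β s)| ≤ k * W * C1 := fun s => by
    rw [abs_mul]
    have := (h1 _ (hl s)).1
    gcongr
    exact hw s
  have b1 : ∀ r, |stdResid (y r) (linPred t β r)| ≤ D := fun r => (h4 _ (hy r) _ (hl r)).1
  have b1' : ∀ r, |stdResid (y r) (linPred t β₀ r)| ≤ D := fun r => (h4 _ (hy r) _ (hl0 r)).1
  have b2 : ∀ r, |linPred t v r * deriv (stdResid (y r)) (linPred t β r)| ≤ k * V * D :=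
    fun r => by
    rw [abs_mul]
    have := (h4 _ (hy r) _ (hl r)).2.1
    gcongr
    exact hv r
  have b2' : ∀ r, |linPred t v r * deriv (stdResid (y r)) (linPred t β₀ r)| ≤ k * V * D :=
    fun r => by
    rw [abs_mul]
    have := (h4 _ (hy r) _ (hl0 r)).2.1
    gcongr
    exact hv r
  have da1 : ∀ s, |linPred t w s * (linPred t v s * deriv respSD (linPred t β s)) -
      linPred t w s * (linPred t v s * deriv respSD (linPred t β₀ s))| ≤
      k * W * (k * V * (C1 * (k * E))) := fun s => by
    rw [← mul_sub, ← mul_sub, abs_mul, abs_mul]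
    have := (((h1 _ (hl s)).2.2 _ (hl0 s)).2).trans (mul_le_mul_of_nonneg_left (hd s) hC1)
    gcongr
    exacts [hw s, hv s]
  have da2 : ∀ s, |linPred t w s * respSD (linPred t β s) -
      linPred t w s * respSD (linPred t β₀ s)| ≤ k * W * (C1 * (k * E)) := fun s => by
    rw [← mul_sub, abs_mul]
    have := (((h1 _ (hl s)).2.2 _ (hl0 s)).1).trans (mul_le_mul_of_nonneg_left (hd s) hC1)
    gcongr
    exact hw s
  have db1 : ∀ r, |stdResid (y r) (linPred t β r) - stdResid (y r) (linPred t β₀ r)| ≤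
      D * (k * E) := fun r =>
    (((h4 _ (hy r) _ (hl r)).2.2 _ (hl0 r)).1).trans (mul_le_mul_of_nonneg_left (hd r) hD0)
  have db2 : ∀ r, |linPred t v r * deriv (stdResid (y r)) (linPred t β r) -
      linPred t v r * deriv (stdResid (y r)) (linPred t β₀ r)| ≤ k * V * (D * (k * E)) :=
    fun r => by
    rw [← mul_sub, abs_mul]
    have := (((h4 _ (hy r) _ (hl r)).2.2 _ (hl0 r)).2).trans (mul_le_mul_of_nonneg_left (hd r) hD0)
    gcongr
    exact hv r
  constructor
  · unfold scoreDeriv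
    refine (abs_add_le _ _).trans ((add_le_add
      (abs_dotProduct_inv_mulVec_le hδ hΓ a1 b1 (by positivity) hD0)
      (abs_dotProduct_inv_mulVec_le hδ hΓ a2 b2 (by positivity) (by positivity))).trans ?_)
    rw [hcard, ← mul_add]
    refine mul_le_mul_of_nonneg_left ?_ hN0
    have : 0 ≤ (δ⁻¹ * (4 * (k ^ 3 * (C1 * D))) + 1) * W * V := by positivity
    nlinarith
  · unfold scoreDeriv
    rw [add_sub_add_comm]
    refine (abs_add_le _ _).trans ((add_le_add
      (abs_dotProduct_inv_mulVec_sub_le hδ hΓ a1 b1' da1 db1 (by positivity) hD0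
        (by positivity) (by positivity))
      (abs_dotProduct_inv_mulVec_sub_le hδ hΓ a2 b2' da2 db2 (by positivity) (by positivity)
        (by positivity) (by positivity))).trans ?_)
    rw [hcard, ← mul_add]
    refine mul_le_mul_of_nonneg_left ?_ hN0
    have : 0 ≤ (δ⁻¹ * (2 * (k ^ 2 * (C1 * D))) + 1) * E * W * V := by positivity
    nlinarith

end

end SpatialQL

/-! ### Roots of strongly monotone maps -/

section Root

variable {E : Type*} [NormedAddCommGroup E] [InnerProductSpace ℝ E]

/-- A strongly monotone Lipschitz map on a ball that is small at the centre has a unique root. -/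
theorem exists_pos_existsUnique_root [CompleteSpace E] {c M r : ℝ} (hc : 0 < c) (hcM : c ≤ M)
    (hr : 0 < r) : ∃ ε : ℝ, 0 < ε ∧ ∀ (F : E → E) (x₀ : E),
      (∀ x ∈ Metric.ball x₀ r, ∀ y ∈ Metric.ball x₀ r,
        inner ℝ (F x - F y) (x - y) ≤ -c * ‖x - y‖ ^ 2) →
      (∀ x ∈ Metric.ball x₀ r, ∀ y ∈ Metric.ball x₀ r, ‖F x - F y‖ ≤ M * ‖x - y‖) →
      ‖F x₀‖ < ε → ∃! x, x ∈ Metric.ball x₀ r ∧ F x = 0 := by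
  have hM : 0 < M := hc.trans_le hcM
  -- This step minimizes `1 - 2 τ c + τ² M²`, the bound on the squared contraction factor of `x ↦ x
  -- + τ F x`, with minimum `q²`. Fixed points of this map are the roots of `F`.
  set τ : ℝ := c / M ^ 2 with hτ
  have hτ0 : 0 < τ := by positivity
  set q : ℝ := Real.sqrt (1 - c ^ 2 / M ^ 2) with hq
  have hq2 : q ^ 2 = 1 - c ^ 2 / M ^ 2 := by
    refine Real.sq_sqrt (sub_nonneg.2 ?_)
    rw [div_le_one (by positivity)]
    exact pow_le_pow_left₀ hc.le hcM 2
  have hq0 : 0 ≤ q := Real.sqrt_nonneg _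
  have hq1 : q < 1 := by
    have : 0 < c ^ 2 / M ^ 2 := by positivity
    nlinarith
  -- Existence uses the closed ball of radius `r / 2`, which is complete; `ε` is the size of `F x₀`
  -- up to which the contraction preserves it.
  refine ⟨(1 - q) * (r / 2) / τ, div_pos (mul_pos (by linarith) (by linarith)) hτ0,
    fun F x₀ hmono hlip h0 => ?_⟩
  have hsub : Metric.closedBall x₀ (r / 2) ⊆ Metric.ball x₀ r :=
    Metric.closedBall_subset_ball (by linarith)
  set G : E → E := fun x => x + τ • F x with hG
  have hcontr : ∀ x ∈ Metric.ball x₀ r, ∀ y ∈ Metric.ball x₀ r, dist (G x) (G y) ≤ q * dist x y := by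
    intro x hx y hy
    have h1 : G x - G y = (x - y) + τ • (F x - F y) := by
      simp only [hG, smul_sub]; abel
    rw [dist_eq_norm, dist_eq_norm, h1]
    refine le_of_sq_le_sq ?_ (by positivity)
    rw [norm_add_sq_real, real_inner_smul_right, norm_smul, Real.norm_of_nonneg hτ0.le,
      real_inner_comm, mul_pow, mul_pow, hq2]
    have h2 := mul_le_mul_of_nonneg_left (hmono x hx y hy) hτ0.le
    have h3 := mul_le_mul_of_nonneg_left
      (pow_le_pow_left₀ (norm_nonneg _) (hlip x hx y hy) 2) (sq_nonneg τ)
    have h4 : 2 * (τ * (-c * ‖x - y‖ ^ 2)) + τ ^ 2 * (M * ‖x - y‖) ^ 2 =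
        -(c ^ 2 / M ^ 2) * ‖x - y‖ ^ 2 := by
      rw [hτ]; field_simp; ring
    linarith
  have hmaps : Set.MapsTo G (Metric.closedBall x₀ (r / 2)) (Metric.closedBall x₀ (r / 2)) := by
    intro x hx
    rw [Metric.mem_closedBall] at hx ⊢
    have h1 := hcontr x (hsub hx) x₀ (Metric.mem_ball_self hr)
    have h2 : dist (G x₀) x₀ = τ * ‖F x₀‖ := by
      rw [dist_eq_norm]
      simp only [hG, add_sub_cancel_left, norm_smul, Real.norm_of_nonneg hτ0.le]
    have h3 : τ * ‖F x₀‖ ≤ (1 - q) * (r / 2) := by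
      rw [lt_div_iff₀ hτ0] at h0
      linarith
    have h4 := dist_triangle (G x) (G x₀) x₀
    have h5 := mul_le_mul_of_nonneg_left hx hq0
    linarith
  have hcw : ContractingWith ⟨q, hq0⟩ (hmaps.restrict G _ _) :=
    ⟨hq1, LipschitzWith.of_dist_le_mul fun x y => hcontr x (hsub x.2) y (hsub y.2)⟩
  obtain ⟨x, hx, hfix, -⟩ := ContractingWith.exists_fixedPoint'
    Metric.isClosed_closedBall.isComplete hmaps hcw
    (Metric.mem_closedBall_self (by linarith : 0 ≤ r / 2)) (edist_ne_top _ _)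
  refine ⟨x, ⟨hsub hx, ?_⟩, ?_⟩
  · have h1 : x + τ • F x = x := hfix
    exact (smul_eq_zero.1 (add_eq_left.1 h1)).resolve_left hτ0.ne'
  · rintro y ⟨hy, hFy⟩
    have h1 : F x = 0 := by
      have h1 : x + τ • F x = x := hfix
      exact (smul_eq_zero.1 (add_eq_left.1 h1)).resolve_left hτ0.ne'
    have h2 := hmono y hy x (hsub hx)
    rw [hFy, h1, sub_zero, inner_zero_left] at h2
    have h3 : ‖y - x‖ ^ 2 = 0 := le_antisymm (by nlinarith) (sq_nonneg _)
    exact sub_eq_zero.1 (norm_eq_zero.1 (pow_eq_zero_iff two_ne_zero |>.1 h3))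

theorem exists_le_abs_apply_of_le_norm {u : ℕ} (x : EuclideanSpace ℝ (Fin (u + 1))) {ε : ℝ}
    (hε : 0 < ε) (hx : ε ≤ ‖x‖) : ∃ j, ε / (u + 1) ≤ |x j| := by
  by_contra! h
  have h1 : ‖x‖ ^ 2 < ε ^ 2 := by
    rw [EuclideanSpace.real_norm_sq_eq]
    calc ∑ j, x j ^ 2 < ∑ _j : Fin (u + 1), (ε / (u + 1)) ^ 2 := by
          refine Finset.sum_lt_sum_of_nonempty Finset.univ_nonempty fun j _ => ?_
          rw [← sq_abs]
          exact pow_lt_pow_left₀ (h j) (abs_nonneg _) two_ne_zero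
      _ = ε ^ 2 / (u + 1) := by
          rw [Finset.sum_const, Finset.card_univ, Fintype.card_fin, nsmul_eq_mul]
          push_cast
          field_simp
      _ ≤ ε ^ 2 := div_le_self (sq_nonneg _) (by linarith [(Nat.cast_nonneg u : (0 : ℝ) ≤ u)])
  exact absurd (pow_le_pow_left₀ hε.le hx 2) (not_le.2 h1)

end Root

/-! ### Monotonicity and moments of the normalized quasi-score -/

namespace SpatialQL

section Monotone

variable {u m n : ℕ} {Γ : Matrix (Site m n) (Site m n) ℝ} {t : Site m n → Fin (u + 1) → ℝ}
  {y : Site m n → ℝ} {β₀ : Param u} {c K r : ℝ}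

/-- The mean value theorem for the quasi-score. -/
theorem exists_inner_quasiScore_sub_eq (hΓ : IsUnit Γ.det) {β β' : Param u}
    (hβ : β ∈ Metric.ball β₀ r) (hβ' : β' ∈ Metric.ball β₀ r) (w : Param u) :
    ∃ ξ ∈ Metric.ball β₀ r, inner ℝ w (quasiScore Γ t y β - quasiScore Γ t y β') =
      scoreDeriv Γ t y ξ w (β - β') := by
  have hd := fun τ : ℝ => hasDerivAt_scoreForm (Γ := Γ) (t := t) (y := y) β' w (β - β') τ
  obtain ⟨τ, hτ, h⟩ := exists_hasDerivAt_eq_slope _ _ (zero_lt_one (α := ℝ))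
    (fun τ _ => (hd τ).continuousAt.continuousWithinAt) (fun τ _ => hd τ)
  refine ⟨β' + τ • (β - β'), ?_, ?_⟩
  · exact (convex_ball β₀ r).add_smul_sub_mem hβ' hβ ⟨hτ.1.le, hτ.2.le⟩
  · rw [h, inner_sub_right, inner_quasiScore hΓ, inner_quasiScore hΓ]
    simp

/-- The mean value theorem is used in the direction `β - β'` for monotonicity, where the drift `K r
≤ c / 2` of the derivative costs half of `c`, and in the direction of the score increment itself for
the Lipschitz bound. -/
theorem quasiScore_monotone_lipschitz (hΓ : IsUnit Γ.det) (hN : 0 < m * n) (hK : 0 < K)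
    (hr1 : r ≤ 1) (hKr : K * r ≤ c / 2)
    (hbd : ∀ β w v : Param u, ‖β - β₀‖ ≤ 1 →
      |scoreDeriv Γ t y β w v| ≤ ((m * n : ℕ) : ℝ) * (K * ‖w‖ * ‖v‖) ∧
      |scoreDeriv Γ t y β w v - scoreDeriv Γ t y β₀ w v| ≤
        ((m * n : ℕ) : ℝ) * (K * ‖β - β₀‖ * ‖w‖ * ‖v‖))
    (hneg : ∀ x : Param u, inner ℝ x ((((m * n : ℕ) : ℝ)⁻¹ •
      fderiv ℝ (quasiScore Γ t y) β₀) x) ≤ -c * ‖x‖ ^ 2) :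
    ∀ β ∈ Metric.ball β₀ r, ∀ β' ∈ Metric.ball β₀ r,
      inner ℝ (((m * n : ℕ) : ℝ)⁻¹ • quasiScore Γ t y β -
        ((m * n : ℕ) : ℝ)⁻¹ • quasiScore Γ t y β') (β - β') ≤ -(c / 2) * ‖β - β'‖ ^ 2 ∧
      ‖((m * n : ℕ) : ℝ)⁻¹ • quasiScore Γ t y β -
        ((m * n : ℕ) : ℝ)⁻¹ • quasiScore Γ t y β'‖ ≤ K * ‖β - β'‖ := by
  intro β hβ β' hβ'
  set N : ℝ := ((m * n : ℕ) : ℝ) with hNdef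
  have hN0 : 0 < N := Nat.cast_pos.2 hN
  rw [← smul_sub]
  constructor
  · obtain ⟨ξ, hξ, h⟩ := exists_inner_quasiScore_sub_eq (t := t) (y := y) hΓ hβ hβ' (β - β')
    rw [mem_ball_iff_norm] at hξ
    rw [real_inner_comm, real_inner_smul_right, h, inv_mul_le_iff₀ hN0]
    have h1 := (hbd ξ (β - β') (β - β') (hξ.le.trans hr1)).2
    have h2 := hneg (β - β')
    rw [smul_apply, real_inner_smul_right, inner_fderiv_quasiScore hΓ,
      inv_mul_le_iff₀ hN0] at h2
    have h3 : K * ‖ξ - β₀‖ ≤ c / 2 := (mul_le_mul_of_nonneg_left hξ.le hK.le).trans hKr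
    have h4 : N * (K * ‖ξ - β₀‖ * ‖β - β'‖ * ‖β - β'‖) ≤ N * (c / 2 * ‖β - β'‖ * ‖β - β'‖) := by
      gcongr
    have h5 := (abs_le.1 h1).2
    nlinarith
  · set Δ := quasiScore Γ t y β - quasiScore Γ t y β' with hΔ
    obtain ⟨ξ, hξ, h⟩ := exists_inner_quasiScore_sub_eq (t := t) (y := y) hΓ hβ hβ' Δ
    rw [mem_ball_iff_norm] at hξ
    have h1 := (le_abs_self _).trans (hbd ξ Δ (β - β') (hξ.le.trans hr1)).1
    rw [← h, real_inner_self_eq_norm_sq] at h1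
    rw [norm_smul, norm_inv, Real.norm_of_nonneg hN0.le, inv_mul_le_iff₀ hN0]
    rcases (norm_nonneg Δ).eq_or_lt with h0 | h0
    · rw [← h0]; positivity
    · refine le_of_mul_le_mul_left ?_ h0
      linarith

end Monotone

section Moments

variable {Ω : Type*} [MeasurableSpace Ω] {μ : Measure Ω} [IsProbabilityMeasure μ]

theorem memLp_binary {Y : Ω → ℝ} (hm : Measurable Y) (hb : ∀ ω, Y ω = 0 ∨ Y ω = 1) :
    MemLp Y 2 μ := by
  refine MemLp.of_bound hm.aestronglyMeasurable 1 (Eventually.of_forall fun ω => ?_)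
  rcases hb ω with h | h <;> simp [h]

theorem variance_binary {Y : Ω → ℝ} (hm : Measurable Y) (hb : ∀ ω, Y ω = 0 ∨ Y ω = 1) :
    Var[Y; μ] = (∫ ω, Y ω ∂μ) * (1 - ∫ ω, Y ω ∂μ) := by
  have h : Y ^ 2 = Y := by
    funext ω
    rcases hb ω with h | h <;> simp [h]
  rw [variance_eq_sub (memLp_binary hm hb), h]
  ring

variable {u m n : ℕ} {t : Site m n → Fin (u + 1) → ℝ} {β₀ : Param u} {Y : Site m n → Ω → ℝ}
  {p a ρ : ℝ}

theorem covariance_stdResid (hYm : ∀ s, Measurable (Y s)) (hYb : ∀ s ω, Y s ω = 0 ∨ Y s ω = 1)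
    (hmean : ∀ s, ∫ ω, Y s ω ∂μ = meanResp t β₀ s)
    (hcorr : ∀ s r, s ≠ r → corr μ (Y s) (Y r) = a * ρ ^ lpDist p s r) (s r : Site m n) :
    cov[fun ω => stdResid (Y s ω) (linPred t β₀ s),
      fun ω => stdResid (Y r ω) (linPred t β₀ r); μ] = corrMatrix a ρ p m n s r := by
  have hint : ∀ s, Integrable (Y s) μ := fun s =>
    (memLp_binary (hYm s) (hYb s)).integrable (by norm_num)
  have hvar : ∀ s, Var[Y s; μ] = respSD (linPred t β₀ s) ^ 2 := fun s => by
    rw [variance_binary (hYm s) (hYb s), hmean, meanResp_variance]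
  have hpos := fun s => respSD_pos (linPred t β₀ s)
  simp only [stdResid_eq]
  rw [covariance_const_mul_left, covariance_const_mul_right, covariance_sub_const_left (hint s),
    covariance_sub_const_right (hint r), corrMatrix, Matrix.of_apply]
  have hs := (hpos s).ne'
  have hr := (hpos r).ne'
  split_ifs with h
  · subst h
    rw [covariance_self (hYm s).aemeasurable, hvar]
    field_simp
  · rw [← hcorr s r h, corr, hvar, hvar, Real.sqrt_sq (hpos s).le, Real.sqrt_sq (hpos r).le]
    field_simp

/-- Chebyshev's inequality for the components of the normalized quasi-score at `β₀`. -/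
theorem measure_le_abs_quasiScore_apply_le {δ : ℝ} (hδ : 0 < δ)
    (hΓ : ∀ v : Site m n → ℝ, δ * (v ⬝ᵥ v) ≤ v ⬝ᵥ (corrMatrix a ρ p m n *ᵥ v))
    (ht : ∀ s j, t s j = 0 ∨ t s j = 1)
    (hYm : ∀ s, Measurable (Y s)) (hYb : ∀ s ω, Y s ω = 0 ∨ Y s ω = 1)
    (hmean : ∀ s, ∫ ω, Y s ω ∂μ = meanResp t β₀ s)
    (hcorr : ∀ s r, s ≠ r → corr μ (Y s) (Y r) = a * ρ ^ lpDist p s r)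
    (hN : 0 < m * n) {ε : ℝ} (hε : 0 < ε) (j : Fin (u + 1)) :
    μ {ω | ε ≤ |((((m * n : ℕ) : ℝ)⁻¹ •
      quasiScore (corrMatrix a ρ p m n) t (fun s => Y s ω) β₀ : Param u)) j|} ≤
      ENNReal.ofReal (δ⁻¹ / ε ^ 2 * ((m * n : ℕ) : ℝ)⁻¹) := by
  set Γ := corrMatrix a ρ p m n with hΓdef
  have hdet := isUnit_det_of_quadratic_bound hδ hΓ
  set N : ℝ := ((m * n : ℕ) : ℝ) with hNdef
  have hN0 : 0 < N := Nat.cast_pos.2 hN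
  set f : Site m n → ℝ := fun s => t s j * respSD (linPred t β₀ s) with hf
  set h : Site m n → ℝ := f ᵥ* Γ⁻¹ with hh
  set Z : Site m n → Ω → ℝ := fun r ω => stdResid (Y r ω) (linPred t β₀ r) with hZ
  have hmem : ∀ r, MemLp (Z r) 2 μ := fun r => by
    simp only [hZ, stdResid_eq]
    exact ((memLp_binary (hYm r) (hYb r)).sub (memLp_const _)).const_mul _
  have hmemh : ∀ r, MemLp (fun ω => h r * Z r ω) 2 μ := fun r => (hmem r).const_mul _
  have hZ0 : ∀ r, ∫ ω, Z r ω ∂μ = 0 := fun r => by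
    simp only [hZ, stdResid_eq]
    rw [integral_const_mul, integral_sub
      ((memLp_binary (hYm r) (hYb r)).integrable (by norm_num)) (integrable_const _), hmean,
      integral_const, meanResp_eq]
    simp
  set S : Ω → ℝ := fun ω => ∑ r, h r * Z r ω with hS
  have hS0 : ∫ ω, S ω ∂μ = 0 := by
    simp only [hS]
    rw [integral_finsetSum _ fun r _ => (hmemh r).integrable (by norm_num)]
    exact Finset.sum_eq_zero fun r _ => by rw [integral_const_mul, hZ0, mul_zero]
  have hSmem : MemLp S 2 μ := memLp_finsetSum _ fun r _ => hmemh r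
  have hscore : ∀ ω, (N⁻¹ • quasiScore Γ t (fun s => Y s ω) β₀ : Param u) j = N⁻¹ * S ω := by
    intro ω
    rw [PiLp.smul_apply, smul_eq_mul, quasiScore_apply hdet, Matrix.dotProduct_mulVec]
    rfl
  -- The coefficients are `h = fᵀ Γ⁻¹` and the residuals have covariance `Γ`, so the variance
  -- collapses to `fᵀ Γ⁻¹ f`, with `|f s| ≤ 1`.
  have hVar : Var[S; μ] ≤ N * δ⁻¹ := by
    have h1 : Var[S; μ] = h ⬝ᵥ (Γ *ᵥ h) := by
      simp only [hS]
      rw [variance_fun_sum hmemh]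
      simp only [dotProduct, Matrix.mulVec, Finset.mul_sum]
      refine Finset.sum_congr rfl fun s _ => Finset.sum_congr rfl fun r _ => ?_
      rw [covariance_const_mul_left, covariance_const_mul_right,
        covariance_stdResid hYm hYb hmean hcorr]
      ring
    have hf1 : ∀ s, |f s| ≤ 1 := fun s => by
      have h2 := respSD_le_one (linPred t β₀ s)
      have h3 := respSD_pos (linPred t β₀ s)
      rcases ht s j with h | h <;> simp [hf, h, abs_of_pos h3, h2]
    rw [h1, Matrix.dotProduct_mulVec, hh, Matrix.vecMul_vecMul, Matrix.nonsing_inv_mul _ hdet,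
      Matrix.vecMul_one, dotProduct_comm, ← Matrix.dotProduct_mulVec]
    refine (le_abs_self _).trans ((abs_dotProduct_inv_mulVec_le hδ hΓ hf1 hf1 zero_le_one
      zero_le_one).trans_eq ?_)
    simp [hNdef]
  have hset : {ω | ε ≤ |(N⁻¹ • quasiScore Γ t (fun s => Y s ω) β₀ : Param u) j|} =
      {ω | N * ε ≤ |S ω - ∫ ω, S ω ∂μ|} := by
    ext ω
    simp only [Set.mem_ofPred_eq, hscore, hS0, sub_zero, abs_mul, abs_inv, abs_of_pos hN0]
    rw [le_inv_mul_iff₀ hN0]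
  rw [hset]
  refine (meas_ge_le_variance_div_sq hSmem (mul_pos hN0 hε)).trans (ENNReal.ofReal_le_ofReal ?_)
  rw [div_le_iff₀ (by positivity)]
  refine hVar.trans_eq ?_
  field_simp

end Moments

/-- The normalized quasi-score at the true parameter tends to zero in probability. -/
theorem tendsto_measure_le_norm_quasiScore {Ω : Type*} [MeasurableSpace Ω] {μ : Measure Ω}
    [IsProbabilityMeasure μ] {m n : ℕ → ℕ} (hN : Tendsto (fun ν => m ν * n ν) atTop atTop)
    {u : ℕ} {t : ∀ ν, Site (m ν) (n ν) → Fin (u + 1) → ℝ} (ht : ∀ ν s j, t ν s j = 0 ∨ t ν s j = 1)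
    {β₀ : Param u} {Y : ∀ ν, Site (m ν) (n ν) → Ω → ℝ} (hYm : ∀ ν s, Measurable (Y ν s))
    (hYb : ∀ ν s ω, Y ν s ω = 0 ∨ Y ν s ω = 1)
    (hmean : ∀ ν s, ∫ ω, Y ν s ω ∂μ = meanResp (t ν) β₀ s) {p a ρ δ : ℝ} (hδ : 0 < δ)
    (hΓ : ∀ (m n : ℕ) (v : Site m n → ℝ), δ * (v ⬝ᵥ v) ≤ v ⬝ᵥ (corrMatrix a ρ p m n *ᵥ v))
    (hcorr : ∀ ν s r, s ≠ r → corr μ (Y ν s) (Y ν r) = a * ρ ^ lpDist p s r)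
    {ε : ℝ} (hε : 0 < ε) :
    Tendsto (fun ν => μ {ω | ε ≤ ‖((m ν * n ν : ℕ) : ℝ)⁻¹ •
      quasiScore (corrMatrix a ρ p (m ν) (n ν)) (t ν) (fun s => Y ν s ω) β₀‖}) atTop (𝓝 0) := by
  have hε' : 0 < ε / (u + 1) := by positivity
  have hlim : Tendsto (fun ν => ∑ _j : Fin (u + 1),
      ENNReal.ofReal (δ⁻¹ / (ε / (u + 1)) ^ 2 * ((m ν * n ν : ℕ) : ℝ)⁻¹)) atTop (𝓝 0) := by
    have h1 : Tendsto (fun ν => δ⁻¹ / (ε / (u + 1)) ^ 2 * ((m ν * n ν : ℕ) : ℝ)⁻¹) atTop (𝓝 0) := by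
      have h := (tendsto_inv_atTop_zero.comp
        (tendsto_natCast_atTop_atTop (R := ℝ) |>.comp hN)).const_mul (δ⁻¹ / (ε / (u + 1)) ^ 2)
      rwa [mul_zero] at h
    have h2 := ENNReal.tendsto_ofReal h1
    rw [ENNReal.ofReal_zero] at h2
    simpa using tendsto_finsetSum (Finset.univ : Finset (Fin (u + 1))) fun _ _ => h2
  refine tendsto_of_tendsto_of_tendsto_of_le_of_le' tendsto_const_nhds hlim
    (Eventually.of_forall fun ν => zero_le) ?_
  filter_upwards [hN.eventually_gt_atTop 0] with ν hν
  calc _ ≤ μ (⋃ j : Fin (u + 1), {ω | ε / (u + 1) ≤ |((((m ν * n ν : ℕ) : ℝ)⁻¹ •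
      quasiScore (corrMatrix a ρ p (m ν) (n ν)) (t ν) (fun s => Y ν s ω) β₀ : Param u)) j|}) :=
        measure_mono fun ω hω => Set.mem_iUnion.2 (exists_le_abs_apply_of_le_norm _ hε hω)
    _ ≤ ∑ j : Fin (u + 1), μ {ω | ε / (u + 1) ≤ |((((m ν * n ν : ℕ) : ℝ)⁻¹ •
      quasiScore (corrMatrix a ρ p (m ν) (n ν)) (t ν) (fun s => Y ν s ω) β₀ : Param u)) j|} :=
        measure_iUnion_fintype_le μ _
    _ ≤ _ := Finset.sum_le_sum fun j _ => measure_le_abs_quasiScore_apply_le hδ (hΓ _ _) (ht ν)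
        (hYm ν) (hYb ν) (hmean ν) (hcorr ν) hν hε' j

end SpatialQL

/-! ### Existence, uniqueness and consistency of the root -/

theorem lemma2p3 {Ω : Type*} [MeasurableSpace Ω] (μ : Measure Ω) [IsProbabilityMeasure μ]
    -- the grids, with numbers of sites tending to infinity
    (m n : ℕ → ℕ) (hN : Tendsto (fun ν => m ν * n ν) atTop atTop)
    -- the design matrices: first column `1`, other entries `0` or `1`
    (u : ℕ) (t : ∀ ν, SpatialQL.Site (m ν) (n ν) → Fin (u + 1) → ℝ)
    (ht0 : ∀ ν s, t ν s 0 = 1) (ht : ∀ ν s j, t ν s j = 0 ∨ t ν s j = 1)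
    -- the binary responses, with logistic means at the true parameter `β₀`
    (β₀ : SpatialQL.Param u)
    (Y : ∀ ν, SpatialQL.Site (m ν) (n ν) → Ω → ℝ)
    (hYm : ∀ ν s, Measurable (Y ν s))
    (hYb : ∀ ν s ω, Y ν s ω = 0 ∨ Y ν s ω = 1)
    (hmean : ∀ ν s, ∫ ω, Y ν s ω ∂μ = SpatialQL.meanResp (t ν) β₀ s)
    -- correlations decreasing exponentially with the `L_p` distance
    (p a ρ : ℝ) (hp : 1 ≤ p) (ha0 : 0 < a) (ha1 : a ≤ 1) (hρ0 : 0 ≤ ρ) (hρ1 : ρ ≤ 1)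
    (hns : ¬ (a = 1 ∧ ρ = 1))
    (hcorr : ∀ ν s r, s ≠ r →
      SpatialQL.corr μ (Y ν s) (Y ν r) = a * ρ ^ SpatialQL.lpDist p s r)
    -- sums of the higher cumulants over distinct sites are `O(N ^ α_k)` with `α_k < k / 2`
    (hcum : ∀ k : ℕ, 3 ≤ k → ∃ α : ℝ, α < (k : ℝ) / 2 ∧
      (fun ν => ∑ i : Fin k ↪ SpatialQL.Site (m ν) (n ν),
        SpatialQL.jointCumulant μ
          (fun j ω => Y ν (i j) ω - SpatialQL.meanResp (t ν) β₀ (i j)))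
        =O[atTop] fun ν => ((m ν * n ν : ℕ) : ℝ) ^ α)
    -- `N⁻¹ D_β U(β₀)` is negative definite, uniformly in `N`, with probability going to `1`
    (hneg : ∃ c : ℝ, 0 < c ∧ Tendsto
      (fun ν => μ {ω | ¬ ∀ x : SpatialQL.Param u,
        inner ℝ x ((((m ν * n ν : ℕ) : ℝ)⁻¹ •
          fderiv ℝ (SpatialQL.quasiScore (SpatialQL.corrMatrix a ρ p (m ν) (n ν)) (t ν)
            (fun s => Y ν s ω)) β₀) x) ≤ -c * ‖x‖ ^ 2})
      atTop (𝓝 0)) :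
    ∃ r₀ : ℝ, 0 < r₀ ∧
      -- with probability going to `1`, `U` has exactly one root in the ball `B(β₀, r₀)`
      Tendsto (fun ν => μ {ω | ¬ ∃! β : SpatialQL.Param u, β ∈ Metric.ball β₀ r₀ ∧
        SpatialQL.quasiScore (SpatialQL.corrMatrix a ρ p (m ν) (n ν)) (t ν)
          (fun s => Y ν s ω) β = 0}) atTop (𝓝 0) ∧
      -- and every estimate that is such a root with probability going to `1` is consistent
      ∀ βhat : ℕ → Ω → SpatialQL.Param u,
        Tendsto (fun ν => μ {ω | ¬ (βhat ν ω ∈ Metric.ball β₀ r₀ ∧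
          SpatialQL.quasiScore (SpatialQL.corrMatrix a ρ p (m ν) (n ν)) (t ν)
            (fun s => Y ν s ω) (βhat ν ω) = 0)}) atTop (𝓝 0) →
        TendstoInMeasure μ βhat atTop (fun _ => β₀) := by
  obtain ⟨δ, hδ, hΓ⟩ := exists_pos_le_corrMatrix hp ha0 ha1 hρ0 hρ1 hns
  obtain ⟨c, hc, hneg⟩ := hneg
  obtain ⟨K, hK, hbd⟩ := SpatialQL.exists_scoreDeriv_bounds β₀ hδ
  -- Radius 1 is where the derivative bounds hold; `c / (2 K)` keeps half of the negative
  -- definiteness.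
  set r : ℝ := min 1 (c / (2 * K)) with hr
  have hr0 : 0 < r := lt_min one_pos (by positivity)
  have hKr : K * r ≤ c / 2 := by
    refine (mul_le_mul_of_nonneg_left (min_le_right _ _) hK.le).trans_eq ?_
    field_simp
  -- The Lipschitz constant is enlarged from `K` to `K + c` only so that it dominates `c / 2`.
  obtain ⟨ε, hε, hroot⟩ := exists_pos_existsUnique_root (E := SpatialQL.Param u)
    (half_pos hc) (show c / 2 ≤ K + c by linarith) hr0
  have hsmall : ∀ {ε : ℝ}, 0 < ε → _ := fun {ε} hε =>
    SpatialQL.tendsto_measure_le_norm_quasiScore hN ht hYm hYb hmean hδ hΓ hcorr hε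
  have hml := fun ν (hν : 0 < m ν * n ν) ω =>
    SpatialQL.quasiScore_monotone_lipschitz (c := c) (r := r)
      (isUnit_det_of_quadratic_bound hδ (hΓ (m ν) (n ν))) hν hK (min_le_left _ _) hKr
      (fun β w v => hbd (m ν) (n ν) _ (hΓ _ _) (t ν) (ht ν) (fun s => Y ν s ω)
        (fun s => hYb ν s ω) β w v)
  refine ⟨r, hr0, ?_, fun βhat hβ => ?_⟩
  · have hlim := hneg.add (hsmall hε)
    rw [add_zero] at hlim
    refine tendsto_of_tendsto_of_tendsto_of_le_of_le' tendsto_const_nhds hlim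
      (Eventually.of_forall fun ν => zero_le) ?_
    filter_upwards [hN.eventually_gt_atTop 0] with ν hν
    refine (measure_mono fun ω hω => ?_).trans (measure_union_le _ _)
    by_contra hω'
    rw [Set.mem_union, not_or] at hω'
    obtain ⟨h1, h2⟩ := hω'
    have h3 := hml ν hν ω (not_not.1 h1)
    have hN0 : ((m ν * n ν : ℕ) : ℝ)⁻¹ ≠ 0 := inv_ne_zero (by exact_mod_cast hν.ne')
    have h4 := hroot _ β₀ (fun x hx y hy => (h3 x hx y hy).1)
      (fun x hx y hy => (h3 x hx y hy).2.trans
        (mul_le_mul_of_nonneg_right (by linarith) (norm_nonneg _))) (not_le.1 h2)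
    simp only [smul_eq_zero, hN0, false_or] at h4
    exact hω h4
  · rw [tendstoInMeasure_iff_norm]
    intro η hη
    -- Monotonicity between a root and `β₀` gives `(c/2) ‖βhat - β₀‖ ≤ ‖F(β₀)‖`, so an error of at
    -- least `η` forces `‖F(β₀)‖ ≥ c η / 2`, outside the two other exceptional events.
    have hlim := (hneg.add hβ).add (hsmall (mul_pos (half_pos hc) hη))
    rw [add_zero, add_zero] at hlim
    refine tendsto_of_tendsto_of_tendsto_of_le_of_le' tendsto_const_nhds hlim
      (Eventually.of_forall fun ν => zero_le) ?_
    filter_upwards [hN.eventually_gt_atTop 0] with ν hν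
    refine (measure_mono fun ω hω => ?_).trans
      ((measure_union_le _ _).trans (add_le_add_left (measure_union_le _ _) _))
    by_contra hω'
    rw [Set.mem_union, Set.mem_union, not_or, not_or] at hω'
    obtain ⟨⟨h1, h2⟩, h3⟩ := hω'
    obtain ⟨hball, hzero⟩ := not_not.1 h2
    have h4 := (hml ν hν ω (not_not.1 h1) _ hball β₀ (Metric.mem_ball_self hr0)).1
    rw [hzero, smul_zero, zero_sub, inner_neg_left] at h4
    set F := ((m ν * n ν : ℕ) : ℝ)⁻¹ • SpatialQL.quasiScore (SpatialQL.corrMatrix a ρ p (m ν) (n ν))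
      (t ν) (fun s => Y ν s ω) β₀ with hF
    have h5 := real_inner_le_norm F (βhat ν ω - β₀)
    have h6 : ‖F‖ < c / 2 * η := not_le.1 h3
    have h7 : η ≤ ‖βhat ν ω - β₀‖ := hω
    have h8 : ‖F‖ * ‖βhat ν ω - β₀‖ < c / 2 * η * ‖βhat ν ω - β₀‖ :=
      mul_lt_mul_of_pos_right h6 (hη.trans_le h7)
    have h9 : c / 2 * η * ‖βhat ν ω - β₀‖ ≤ c / 2 * ‖βhat ν ω - β₀‖ ^ 2 := by
      rw [sq, ← mul_assoc]
      gcongr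
    linarith
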